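/- All graphs are finite, simple and undirected. A \emph{colored graph} $(G,\varphi)$ is a graph $G=(V,E)$ with an arbitrary (not necessarily proper) map $\varphi:V\to\mathbb{N}$; its \emph{color classes} are the nonempty sets $\varphi^{-1}(c)$, $c\in\varphi(V)$, and its \emph{cluster size} is the maximum cardinality of a color class. The \emph{cluster graph} $G_\varphi$ has vertex set $\varphi(V)$, and two distinct colors $a,b$ are adjacent in $G_\varphi$ whenever there is an edge $uv\in E$ with $\varphi(u)=a$ and $\varphi(v)=b$. A set $S\subseteq V$ is \emph{multicolored} if it contains exactly one vertex of each color class, and it is a \emph{multicolored realization} of $G_\varphi$ if, moreover, the restriction of $\varphi$ to $S$ is an isomorphism from the induced subgraph $G[S]$ onto $G_\varphi$. The \emph{multicolored graph realization} problem (MGR) asks, given a colored graph $(G,\varphi)$, whether $G_\varphi$ has a multicolored realization. \textbf{Proposition.} MGR is solvable in polynomial time for colored graphs with cluster size at most $2$. That is, there are a deterministic Turing machine and a polynomial $p$ such that, for every colored graph $(G,\varphi)$ on a vertex set $\{0,\dots,n-1\}$ with cluster size at most $2$, given as input the encoding $x$ of $(G,\varphi)$ by the adjacency matrix of $G$ and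 the colors of the vertices written in binary, the machine decides in at most $p(|x|)$ steps whether $G_\varphi$ has a multicolored realization. -/

import Mathlib

namespace SimpleGraph

variable {V : Type*}

/-- The cluster graph of the colored graph `(G, φ)`. Its vertices are the colors that are used
(equivalently, the nonempty color classes); two distinct colors `a`, `b` are adjacent
when some edge of `G` joins a vertex of color `a` to a vertex of color `b`. -/
def clusterGraph (G : SimpleGraph V) (φ : V → ℕ) : SimpleGraph (Set.range φ) where
  Adj a b := a ≠ b ∧ ∃ u v : V, G.Adj u v ∧ φ u = a ∧ φ v = b
  symm := ⟨fun _ _ ⟨hne, u, v, h, hu, hv⟩ => ⟨hne.symm, v, u, h.symm, hv, hu⟩⟩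
  loopless := ⟨fun _ h => h.1 rfl⟩

/-- `S` is multicolored: it contains exactly one vertex of each color class. -/
def IsMulticolored (φ : V → ℕ) (S : Set V) : Prop :=
  ∀ c ∈ Set.range φ, (S ∩ φ ⁻¹' {c}).ncard = 1

/-- `S` is a multicolored realization of the cluster graph: it is multicolored, and the restriction
of `φ` to `S` is a graph isomorphism from `G[S]` onto the cluster graph. -/
def IsMulticoloredRealization (G : SimpleGraph V) (φ : V → ℕ) (S : Set V) : Prop :=
  IsMulticolored φ S ∧
    ∃ e : G.induce S ≃g G.clusterGraph φ, ∀ u : S, (e u : ℕ) = φ u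

end SimpleGraph

/-- A finite colored graph `(G, φ)` on the vertices `0, …, n - 1`; the coloring is arbitrary, it need
not be proper. -/
structure ColoredGraph where
  /-- the number of vertices -/
  n : ℕ
  /-- the graph -/
  G : SimpleGraph (Fin n)
  /-- the coloring -/
  φ : Fin n → ℕ

namespace ColoredGraph

open Computability

/-- The cluster size: the maximum cardinality of a color class (`0` if there are no vertices). -/
def clusterSize (I : ColoredGraph) : ℕ :=
  Finset.univ.sup fun v : Fin I.n => (Finset.univ.filter fun w : Fin I.n => I.φ w = I.φ v).card

/-- The question of the multicolored graph realization problem: does the cluster graph have a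
multicolored realization? -/
def HasMulticoloredRealization (I : ColoredGraph) : Prop :=
  ∃ S : Set (Fin I.n), I.G.IsMulticoloredRealization I.φ S

open Classical in
/-- The word that describes the vertex `i`: its color in binary, a comma, the row `i` of the adjacency
matrix, and an end marker. -/
noncomputable def encodeVertex (I : ColoredGraph) (i : Fin I.n) : List Γ' :=
  (encodeNat (I.φ i)).map Γ'.bit ++ Γ'.comma ::
    (List.ofFn fun j : Fin I.n => Γ'.bit (decide (I.G.Adj i j))) ++ [Γ'.ket]

/-- The encoding of a colored graph as an input word: the words of its vertices, in order. -/
noncomputable def encode (I : ColoredGraph) : List Γ' :=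
  (List.ofFn I.encodeVertex).flatten

theorem append_cons_inj {α : Type} (k : α) : ∀ v w x y : List α, k ∉ v → k ∉ w →
    v ++ k :: x = w ++ k :: y → v = w ∧ x = y
  | [], [], _, _, _, _, h => by simpa using h
  | [], b :: w, _, _, _, hw, h => by simp_all
  | a :: v, [], _, _, hv, _, h => by simp_all
  | a :: v, b :: w, x, y, hv, hw, h => by
    simp only [List.cons_append, List.cons.injEq, List.mem_cons, not_or] at h hv hw ⊢
    obtain ⟨h1, h2⟩ := append_cons_inj k v w x y hv.2 hw.2 h.2
    exact ⟨⟨h.1, h1⟩, h2⟩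

theorem flatten_append_singleton_injective {α : Type} (k : α) :
    ∀ L M : List (List α), (∀ w ∈ L, k ∉ w) → (∀ w ∈ M, k ∉ w) →
      (L.map (· ++ [k])).flatten = (M.map (· ++ [k])).flatten → L = M
  | [], [], _, _, _ => rfl
  | [], _ :: _, _, _, h => by simp at h
  | _ :: _, [], _, _, h => by simp at h
  | v :: L, w :: M, hL, hM, h => by
    simp only [List.map_cons, List.flatten_cons, List.append_assoc, List.singleton_append] at h
    obtain ⟨h1, h2⟩ := append_cons_inj k v w _ _ (hL v (by simp)) (hM w (by simp)) h
    rw [h1, flatten_append_singleton_injective k L M (fun u hu => hL u (by simp [hu]))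
      (fun u hu => hM u (by simp [hu])) h2]

/-- Different colored graphs have different encodings. -/
theorem encode_injective : Function.Injective encode := by
  classical
  rintro ⟨n, G, φ⟩ ⟨m, H, ψ⟩ h
  let w (I : ColoredGraph) (i : Fin I.n) : List Γ' :=
    (encodeNat (I.φ i)).map Γ'.bit ++ Γ'.comma ::
      (List.ofFn fun j : Fin I.n => Γ'.bit (decide (I.G.Adj i j)))
  have he (I : ColoredGraph) : I.encode = ((List.ofFn (w I)).map (· ++ [Γ'.ket])).flatten := by
    simp only [encode, List.map_ofFn]
    congr 2
  have hk (I : ColoredGraph) : ∀ u ∈ List.ofFn (w I), Γ'.ket ∉ u := by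
    intro u hu
    obtain ⟨i, rfl⟩ := List.mem_ofFn.1 hu
    simp [w]
  rw [he, he] at h
  have h := flatten_append_singleton_injective _ _ _ (hk _) (hk _) h
  obtain rfl : n = m := by simpa using congrArg List.length h
  have h := List.ofFn_injective h
  have h' (i : Fin n) := (List.append_cons_inj_of_notMem (by simp) (by simp)).1 (congrFun h i)
  have hφ : φ = ψ := by
    funext i
    have := List.map_injective_iff.2 (fun a b hab => by simpa using hab) (h' i).1
    exact encodingNatBool.encode_injective this
  have hG : G = H := by
    ext i j
    have := congrFun (List.ofFn_injective (h' i).2.2) j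
    simpa using this
  rw [hφ, hG]

end ColoredGraph

/-- The decision problem `P`, with instances `a : α` given to the machine as words `enc a`, is
solvable in polynomial time: some (multi-stack) Turing machine outputs the correct answer
on every instance, in a number of steps bounded by a polynomial in the length of the input word. -/
def SolvableInPolyTime {α Γ : Type} (enc : α → List Γ) (P : α → Prop) : Prop :=
  ∃ f : α → Bool, (∀ a, f a = true ↔ P a) ∧
    Nonempty (Turing.TM2ComputableInPolyTime enc Computability.encodeBool f)

/-! A color class with at most two vertices leaves a binary choice, so the problem is 2-SAT in
disguise. A set is a realization exactly when it meets every class and contains no pair in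
`BaseConflict`: two vertices of one class, or two nonadjacent vertices whose colors are adjacent in
the cluster graph (`hasMulticoloredRealization_iff_baseConflict`). `Conflict` closes the forbidden
pairs under resolution: if `a` and `b` exhaust a class, `u` excludes `a` and `v` excludes `b`, then
`u` excludes `v`. An instance is negative iff some class consists of vertices that are in conflict
with themselves (`hasMulticoloredRealization_iff`). Resolution is sound because `a` or `b` has to be
chosen; it is complete because a maximal conflict-free set then meets every class.

The machine is obtained by compiling through layers. Fragments of a stack machine become `TM2`
machines (`solvableInPolyTime_of_exec`). Structured programs, all of whose loops run as often as the
input is long, take polynomial time by a potential argument (`Prog.exec_compile`). Commands on unary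
counters and Boolean tables of size `M × M`, where `M` is the input length plus one, are simulated
by such programs (`Cmd.eval_comp`).

On top of this, the algorithm is a short list of Datalog-like rules, each applied under all
assignments of its variables. A rule whose head does not occur in its body needs a single pass
(`rulePass_self`). The recursive resolution rule is applied in `M * M` passes, after which it is
saturated (`rulePass_iterate_fixed`). -/

namespace StackMachine

open Computability Function

/-! ### Stack machine fragments and their composition. -/

/-- An instruction: push a letter and continue, or pop a letter and continue depending on it. -/
inductive Instr (K A Λ : Type) where
  | push (k : K) (a : A) (next : Λ)
  | pop (k : K) (next : Option A → Λ)

namespace Instr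

variable {K A Λ Λ' : Type}

/-- Rename the labels to which an instruction continues. -/
def map (g : Λ → Λ') : Instr K A Λ → Instr K A Λ'
  | push k a l => push k a (g l)
  | pop k f => pop k (g ∘ f)

/-- Execute an instruction. -/
def step [DecidableEq K] : Instr K A Λ → (K → List A) → Λ × (K → List A)
  | push k a l, S => (l, update S k (a :: S k))
  | pop k f, S => (f (S k).head?, update S k (S k).tail)

theorem step_map [DecidableEq K] (g : Λ → Λ') (i : Instr K A Λ) (S : K → List A) :
    (i.map g).step S = (g (i.step S).1, (i.step S).2) := by
  cases i <;> rfl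

end Instr

/-- A machine fragment: finitely many labels with an instruction each, where `none` stands for the
exit of the fragment. -/
structure Frag (K A : Type) where
  /-- the labels -/
  Λ : Type
  /-- there are finitely many labels -/
  fin : Fintype Λ
  /-- the instruction at a label -/
  code : Λ → Instr K A (Option Λ)
  /-- the label at which the fragment starts -/
  start : Option Λ

namespace Frag

variable {K A : Type} [DecidableEq K]

/-- `F.Run l S t S'`: started at the label `l` with stacks `S`, the fragment exits after exactly `t`
steps with stacks `S'`. -/
inductive Run (F : Frag K A) : Option F.Λ → (K → List A) → ℕ → (K → List A) → Prop
  | exit (S : K → List A) : Run F none S 0 S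
  | step {l : F.Λ} {S : K → List A} {t : ℕ} {S' : K → List A}
      (h : Run F ((F.code l).step S).1 ((F.code l).step S).2 t S') : Run F (some l) S (t + 1) S'

/-- Running a fragment from its start. -/
def Exec (F : Frag K A) (S : K → List A) (t : ℕ) (S' : K → List A) : Prop :=
  F.Run F.start S t S'

/-- Simulation lemma behind the combinators: a run of `F` is replayed step by step in its copy
inside `G`, whose exits are redirected to `x`. -/
theorem Run.embed {F G : Frag K A} (e : F.Λ → G.Λ) (x : Option G.Λ)
    (he : ∀ l, G.code (e l) = (F.code l).map fun o => o.elim x (fun l' => some (e l')))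
    {l : Option F.Λ} {S S' S'' : K → List A} {t t' : ℕ} (h : F.Run l S t S')
    (h' : G.Run x S' t' S'') :
    G.Run (l.elim x fun l' => some (e l')) S (t + t') S'' := by
  induction h with
  | exit S => simpa using h'
  | step h ih =>
    rw [Nat.add_right_comm]
    refine Run.step ?_
    rw [he, Instr.step_map]
    exact ih h'

/-- The fragment that does nothing. -/
def skip : Frag K A := ⟨Empty, inferInstance, fun l => l.elim, none⟩

theorem exec_skip (S : K → List A) : (skip : Frag K A).Exec S 0 S := Run.exit S

/-- The fragment that pushes a letter. -/
def push (k : K) (a : A) : Frag K A :=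
  ⟨Unit, inferInstance, fun _ => .push k a none, some ()⟩

theorem exec_push (k : K) (a : A) (S : K → List A) :
    (push k a).Exec S 1 (update S k (a :: S k)) := Run.step (Run.exit _)

/-- Sequential composition. -/
def seq (F G : Frag K A) : Frag K A where
  Λ := F.Λ ⊕ G.Λ
  fin := by have := F.fin; have := G.fin; infer_instance
  code := Sum.elim
    (fun l => (F.code l).map fun o => o.elim (G.start.elim none fun l' => some (.inr l'))
      fun l' => some (.inl l'))
    (fun l => (G.code l).map fun o => o.elim none fun l' => some (.inr l'))
  start := F.start.elim (G.start.elim none fun l' => some (.inr l')) fun l' => some (.inl l')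

theorem exec_seq {F G : Frag K A} {S S' S'' : K → List A} {t t' : ℕ} (h : F.Exec S t S')
    (h' : G.Exec S' t' S'') : (F.seq G).Exec S (t + t') S'' := by
  have h1 : (F.seq G).Run (G.start.elim none fun l' => some (.inr l')) S' t' S'' := by
    simpa using Run.embed (G := F.seq G) Sum.inr none (fun _ => rfl) h' (Run.exit S'')
  exact Run.embed (G := F.seq G) Sum.inl _ (fun _ => rfl) h h1

variable [Fintype A]

/-- Pop a letter and continue depending on it. -/
def popCase (k : K) (f : Option A → Frag K A) : Frag K A where
  Λ := Option (Σ o, (f o).Λ)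
  fin := by have := fun o => (f o).fin; infer_instance
  code l := l.elim (.pop k fun o => (f o).start.elim none fun l' => some (some ⟨o, l'⟩))
    fun l => ((f l.1).code l.2).map fun o => o.elim none fun l' => some (some ⟨l.1, l'⟩)
  start := some none

theorem exec_popCase {k : K} {f : Option A → Frag K A} {S S' : K → List A} {t : ℕ}
    (h : (f (S k).head?).Exec (update S k (S k).tail) t S') :
    (popCase k f).Exec S (t + 1) S' := by
  refine Run.step ?_
  exact Run.embed (G := popCase k f) (fun l => some ⟨_, l⟩) none (fun _ => rfl) h (Run.exit S')

/-- Pop letters as long as there are any, and execute a fragment for each of them. -/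
def whilePop (k : K) (f : A → Frag K A) : Frag K A where
  Λ := Option (Σ a, (f a).Λ)
  fin := by have := fun a => (f a).fin; infer_instance
  code l := l.elim (.pop k fun o => o.elim none fun a =>
      (f a).start.elim (some none) fun l' => some (some ⟨a, l'⟩))
    fun l => ((f l.1).code l.2).map fun o => o.elim (some none) fun l' => some (some ⟨l.1, l'⟩)
  start := some none

theorem exec_whilePop_nil {k : K} {f : A → Frag K A} {S : K → List A} (h : S k = []) :
    (whilePop k f).Exec S 1 S := by
  refine Run.step ?_
  have : update S k (S k).tail = S := by simp [h, update_eq_self_iff]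
  simp only [whilePop, Option.elim_none, Instr.step, h, List.head?_nil]
  rw [← h, this]
  exact Run.exit S

theorem exec_whilePop_cons {k : K} {f : A → Frag K A} {S S' S'' : K → List A} {a : A} {l : List A}
    {t t' : ℕ} (h : S k = a :: l) (h1 : (f a).Exec (update S k l) t S')
    (h2 : (whilePop k f).Exec S' t' S'') : (whilePop k f).Exec S (t + t' + 1) S'' := by
  refine Run.step ?_
  simp only [whilePop, Option.elim_none, Instr.step, h, List.head?_cons, List.tail_cons]
  exact Run.embed (G := whilePop k f) (fun l => some ⟨a, l⟩) (some none) (fun _ => rfl) h1 h2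

end Frag

/-! ### From fragments to Turing machines. -/

section FinTM2

open Turing

variable {K : Type} [DecidableEq K]

/-- The stack alphabets of the Turing machine of a fragment: there is one more stack, for the
output. -/
abbrev StackAlphabet : Option K → Type
  | none => Bool
  | some _ => Γ'

/-- The statement of the Turing machine for an instruction. -/
def Instr.toStmt {Λ : Type} : Instr K Γ' (Option Λ) →
    TM2.Stmt (StackAlphabet (K := K)) (Option Λ) (Option Γ')
  | push k a l => .push (some k) (fun _ => a) (.goto fun _ => l)
  | pop k f => .pop (some k) (fun _ o => o) (.goto fun o => f o)

/-- The contents of the stacks of the Turing machine, with an empty output stack. -/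
def fullStacks (S : K → List Γ') : ∀ k : Option K, List (StackAlphabet k)
  | none => []
  | some k => S k

theorem update_fullStacks (S : K → List Γ') (k : K) (l : List Γ') :
    update (fullStacks S) (some k) l = fullStacks (update S k l) := by
  funext k'
  cases k' with
  | none => rfl
  | some k' =>
    by_cases h : k' = k
    · subst h; simp [fullStacks]
    · simp [fullStacks, h]

/-- The internal state only carries a popped letter to the jump right after it. It is never read
before being overwritten, so its old and new values do not matter. -/
theorem Instr.stepAux_toStmt {Λ : Type} (i : Instr K Γ' (Option Λ)) (v : Option Γ')
    (S : K → List Γ') :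
    ∃ v', TM2.stepAux i.toStmt v (fullStacks S) = ⟨some (i.step S).1, v', fullStacks (i.step S).2⟩ := by
  cases i with
  | push k a l =>
    refine ⟨v, ?_⟩
    simp only [toStmt, TM2.stepAux, step]
    rw [← update_fullStacks]
    rfl
  | pop k f =>
    refine ⟨(S k).head?, ?_⟩
    simp only [toStmt, TM2.stepAux, step]
    rw [← update_fullStacks]
    rfl

variable [Fintype K]

/-- The Turing machine that runs a fragment and then pops a bit from the stack `ans` and outputs it. -/
def Frag.toFinTM2 (F : Frag K Γ') (inp ans : K) : FinTM2 where
  K := Option K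
  k₀ := some inp
  k₁ := none
  Γ := StackAlphabet
  Λ := Option F.Λ
  main := F.start
  ΛFin := by have := F.fin; infer_instance
  σ := Option Γ'
  initialState := none
  Γk₀Fin := inferInstanceAs (Fintype Γ')
  m l := l.elim
    (.pop (some ans) (fun _ o => o)
      (.push none (fun o => decide (o = some (Γ'.bit true))) (.load (fun _ => none) .halt)))
    fun l => (F.code l).toStmt

theorem Frag.Run.iterate_step {F : Frag K Γ'} (inp ans : K) {l : Option F.Λ} {S S' : K → List Γ'}
    {t : ℕ} (h : F.Run l S t S') (v : Option Γ') :
    ∃ v', (flip bind (F.toFinTM2 inp ans).step)^[t]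
      (some (⟨some l, v, fullStacks S⟩ : TM2.Cfg StackAlphabet (Option F.Λ) (Option Γ'))) =
      some (⟨some none, v', fullStacks S'⟩ : TM2.Cfg StackAlphabet (Option F.Λ) (Option Γ')) := by
  induction h generalizing v with
  | exit S => exact ⟨v, rfl⟩
  | @step l S t S' h ih =>
    obtain ⟨v1, h1⟩ := (F.code l).stepAux_toStmt v S
    obtain ⟨v2, h2⟩ := ih v1
    refine ⟨v2, ?_⟩
    rw [iterate_succ_apply, ← h2, ← h1]
    rfl

/-- The additional step is the one at label `none`, which transfers the answer bit. A `haltList`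
configuration has no other nonempty stack and the initial internal state, so the fragment must leave
nothing but the answer behind. -/
theorem Frag.Exec.evalsTo {F : Frag K Γ'} {inp ans : K} {x : List Γ'} {b : Bool} {t : ℕ}
    (h : F.Exec (update (fun _ => []) inp x) t (update (fun _ => []) ans [Γ'.bit b])) :
    (flip bind (F.toFinTM2 inp ans).step)^[t + 1] (some (initList (F.toFinTM2 inp ans) x)) =
      some (haltList (F.toFinTM2 inp ans) [b]) := by
  obtain ⟨v, hv⟩ := h.iterate_step inp ans none
  have h1 : initList (F.toFinTM2 inp ans) x =
      (⟨some F.start, none, fullStacks (update (fun _ => []) inp x)⟩ :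
        TM2.Cfg StackAlphabet (Option F.Λ) (Option Γ')) := by
    unfold initList
    congr 1
    funext k
    cases k with
    | none => rfl
    | some k =>
      by_cases hk : k = inp
      · subst hk
        simp [fullStacks, toFinTM2]
        rfl
      · have : (some k : Option K) ≠ some inp := by simpa using hk
        simp [fullStacks, hk, toFinTM2]
  rw [iterate_succ_apply', h1, hv]
  change some (TM2.stepAux _ _ _) = _
  simp only [TM2.stepAux, toFinTM2, Option.elim_none]
  congr 1
  unfold haltList
  congr 1
  funext k
  cases k with
  | none => simp [fullStacks]
  | some k =>
    have hu := congrFun (update_fullStacks (update (fun _ => []) ans [Γ'.bit b]) ans []) (some k)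
    by_cases hk : k = ans
    · subst hk
      simp only [fullStacks, update_self]
      exact hu.trans (by simp [fullStacks])
    · simp only [fullStacks, update_self]
      exact hu.trans (by simp [fullStacks, hk])

theorem solvableInPolyTime_of_exec {α : Type} {enc : α → List Γ'} {P : α → Prop} (f : α → Bool)
    (hf : ∀ a, f a = true ↔ P a) (F : Frag K Γ') (inp ans : K) (p : Polynomial ℕ)
    (h : ∀ a, ∃ t ≤ p.eval (enc a).length,
      F.Exec (update (fun _ => []) inp (enc a)) t (update (fun _ => []) ans [Γ'.bit (f a)])) :
    SolvableInPolyTime enc P := by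
  refine ⟨f, hf, ⟨⟨⟨F.toFinTM2 inp ans, Equiv.refl Γ', Equiv.refl Bool⟩, p + 1, fun a => ?_⟩⟩⟩
  refine ⟨⟨(h a).choose + 1, ?_⟩, ?_⟩
  · have := (h a).choose_spec.2.evalsTo
    -- Input and output words pass through identity equivalences; they are generalized here so that
    -- `List.map_id` can be applied at the end.
    have key : ∀ x y, x = enc a → y = [f a] →
        (flip bind (F.toFinTM2 inp ans).step)^[(h a).choose + 1]
          (some (initList (F.toFinTM2 inp ans) x)) = some (haltList (F.toFinTM2 inp ans) y) := by
      rintro _ _ rfl rfl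
      exact this
    exact key _ _ (List.map_id _) (List.map_id _)
  · simpa using (h a).choose_spec.1

end FinTM2

/-! ### Clearing, moving and filling stacks. -/

namespace Frag

variable {K A : Type} [DecidableEq K] [Fintype A]

omit [Fintype A] in
theorem Exec.cast {F : Frag K A} {S S' T : K → List A} {t u : ℕ} (h : F.Exec S t S') (ht : t = u)
    (hT : S' = T) : F.Exec S u T := ht ▸ hT ▸ h

theorem exec_clear (k : K) (S : K → List A) :
    (whilePop k fun _ => skip).Exec S ((S k).length + 1) (update S k []) := by
  generalize hl : S k = l
  induction l generalizing S with
  | nil => exact (exec_whilePop_nil hl).cast rfl (by simp [← hl])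
  | cons a l ih =>
    have := exec_whilePop_cons hl (exec_skip _) (ih (update S k l) (by simp))
    exact this.cast (by simp) (by simp)

theorem exec_move {k k' : K} (hk : k ≠ k') (S : K → List A) :
    (whilePop k fun a => push k' a).Exec S (2 * (S k).length + 1)
      (update (update S k []) k' ((S k).reverse ++ S k')) := by
  generalize hl : S k = l
  induction l generalizing S with
  | nil =>
    refine (exec_whilePop_nil hl).cast rfl ?_
    rw [← hl, update_eq_self, hl, List.reverse_nil, List.nil_append, update_eq_self]
  | cons a l ih =>
    have := exec_whilePop_cons hl (exec_push k' a _) (ih _ (by simp [hk]))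
    refine this.cast (by simp; ring) ?_
    funext j
    by_cases h1 : j = k'
    · subst h1; simp [hk.symm]
    · by_cases h2 : j = k
      · subst h2; simp [h1]
      · simp [h1, h2]

/-- Clear several stacks. -/
def clearAll : List K → Frag K A
  | [] => skip
  | k :: ks => (whilePop k fun _ => skip).seq (clearAll ks)

/-- Only an upper bound on the time: a stack that is listed twice is already empty the second time.
-/
theorem exec_clearAll (ks : List K) (S : K → List A) :
    ∃ t ≤ (ks.map fun k => (S k).length + 1).sum,
      (clearAll ks).Exec S t fun k => if k ∈ ks then [] else S k := by
  induction ks generalizing S with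
  | nil => exact ⟨0, by simp, (exec_skip S).cast rfl (by simp)⟩
  | cons k ks ih =>
    obtain ⟨t, ht, h⟩ := ih (update S k [])
    refine ⟨_, ?_, (exec_seq (exec_clear k S) h).cast rfl ?_⟩
    · simp only [List.map_cons, List.sum_cons]
      refine Nat.add_le_add_left (ht.trans (List.sum_le_sum fun j _ => ?_)) _
      by_cases hj : j = k <;> simp [hj]
    · funext j
      by_cases hj : j = k <;> simp [hj]

/-- Push a letter to several stacks. -/
def pushAll (a : A) : List K → Frag K A
  | [] => skip
  | k :: ks => (push k a).seq (pushAll a ks)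

omit [Fintype A] in
theorem exec_pushAll (a : A) (ks : List K) (hks : ks.Nodup) (S : K → List A) :
    (pushAll a ks).Exec S ks.length fun k => if k ∈ ks then a :: S k else S k := by
  induction ks generalizing S with
  | nil => exact (exec_skip S).cast rfl (by simp)
  | cons k ks ih =>
    rw [List.nodup_cons] at hks
    refine (exec_seq (exec_push k a S) (ih hks.2 _)).cast (by simp [add_comm]) ?_
    funext j
    by_cases hj : j = k
    · subst hj; simp [hks.1]
    · simp [hj]

end Frag

/-! ### Structured programs and their amortized running time. -/

/-- Structured programs. All loops are executed the same number of times. -/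
inductive Prog (K A : Type) where
  | skip : Prog K A
  | push (k : K) (a : A) : Prog K A
  | pop (k : K) (f : Option A → Prog K A) : Prog K A
  | seq (p q : Prog K A) : Prog K A
  | clear (k : K) : Prog K A
  | loop (p : Prog K A) : Prog K A

namespace Prog

variable {K A L : Type} [DecidableEq K] [DecidableEq L]

/-- The effect of a program on the stacks if loops are executed `N` times. -/
def eval (N : ℕ) : Prog K A → (K → List A) → K → List A
  | skip, S => S
  | push k a, S => update S k (a :: S k)
  | pop k f, S => (f (S k).head?).eval N (update S k (S k).tail)
  | seq p q, S => q.eval N (p.eval N S)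
  | clear k, S => update S k []
  | loop p, S => (p.eval N)^[N] S

variable [Fintype A]

/-- The nesting depth of loops. -/
def depth : Prog K A → ℕ
  | pop _ f => Finset.univ.sup fun o => (f o).depth
  | seq p q => max p.depth q.depth
  | loop p => p.depth + 1
  | _ => 0

/-- A bound for the amortized running time in terms of the number of executions of loops. -/
noncomputable def cost : Prog K A → Polynomial ℕ
  | skip => 0
  | push _ _ => 2
  | pop _ f => 1 + ∑ o, (f o).cost
  | seq p q => p.cost + q.cost
  | clear _ => 1
  | loop p => Polynomial.X * (p.cost + 4) + 2

/-- The fragment for a program; loops of nesting depth `d` are controlled by two stacks with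
index `lev d`. -/
def compile (lev : ℕ → L) : Prog K A → Frag (K ⊕ L × Bool) A
  | skip => .skip
  | push k a => .push (.inl k) a
  | pop k f => .popCase (.inl k) fun o => (f o).compile lev
  | seq p q => (p.compile lev).seq (q.compile lev)
  | clear k => .whilePop (.inl k) fun _ => .skip
  | loop p =>
    .seq
      (.whilePop (.inr (lev p.depth, false)) fun a =>
        (Frag.push (.inr (lev p.depth, true)) a).seq (p.compile lev))
      (.whilePop (.inr (lev p.depth, true)) fun a => .push (.inr (lev p.depth, false)) a)

/-- The stacks that control the loops of depth less than `d` are in their resting state. -/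
def Ready (lev : ℕ → L) (N d : ℕ) (a : A) (C : L × Bool → List A) : Prop :=
  ∀ i < d, C (lev i, false) = List.replicate N a ∧ C (lev i, true) = []

omit [DecidableEq L] [Fintype A] in
theorem Ready.mono {lev : ℕ → L} {N d d' : ℕ} {a : A} {C : L × Bool → List A}
    (h : Ready lev N d a C) (hd : d' ≤ d) : Ready lev N d' a C := fun i hi => h i (hi.trans_le hd)

variable [Fintype K]

omit [Fintype A] in
theorem sum_length_update (S : K → List A) (k : K) (l : List A) :
    ∑ j, (update S k l j).length + (S k).length = ∑ j, (S j).length + l.length := by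
  rw [← Finset.add_sum_erase _ _ (Finset.mem_univ k),
    ← Finset.add_sum_erase _ (fun j => (S j).length) (Finset.mem_univ k)]
  have : ∑ x ∈ Finset.univ.erase k, (update S k l x).length =
      ∑ x ∈ Finset.univ.erase k, (S x).length :=
    Finset.sum_congr rfl fun j hj => by simp [Finset.ne_of_mem_erase hj]
  simp only [update_self, this]
  ring

/-- The total length of the data stacks serves as a potential. Clearing a stack costs its length,
which was paid for by the pushes, so each construct has an amortized cost that depends on `N` alone.
The bound also controls the final stack lengths. -/
theorem exec_compile {lev : ℕ → L} {D : ℕ} (hlev : Set.InjOn lev (Set.Iic D)) (N : ℕ) (a₀ : A)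
    (p : Prog K A) (hD : p.depth ≤ D) (C : L × Bool → List A) (hC : Ready lev N p.depth a₀ C)
    (S : K → List A) :
    ∃ t, (p.compile lev).Exec (Sum.elim S C) t (Sum.elim (p.eval N S) C) ∧
      t + ∑ k, (p.eval N S k).length ≤ ∑ k, (S k).length + p.cost.eval N := by
  induction p generalizing C S with
  | skip => exact ⟨0, Frag.exec_skip _, by simp [eval]⟩
  | push k a =>
    refine ⟨1, (Frag.exec_push _ a _).cast rfl (by simp only [eval, Sum.elim_inl, Sum.update_elim_inl]), ?_⟩
    have := sum_length_update S k (a :: S k)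
    simp [eval, cost] at this ⊢
    omega
  | pop k f ih =>
    have hle (o) : (f o).depth ≤ (pop k f).depth :=
      Finset.le_sup (f := fun o => (f o).depth) (Finset.mem_univ o)
    obtain ⟨t, h, ht⟩ := ih (S k).head? ((hle _).trans hD) C (hC.mono (hle _))
      (update S k (S k).tail)
    refine ⟨t + 1, Frag.exec_popCase (by simpa only [eval, Sum.elim_inl, Sum.update_elim_inl] using h), ?_⟩
    have h1 := sum_length_update S k (S k).tail
    have h2 : (f (S k).head?).cost.eval N ≤ ∑ o, (f o).cost.eval N :=
      Finset.single_le_sum (f := fun o => (f o).cost.eval N) (fun _ _ => Nat.zero_le _)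
        (Finset.mem_univ _)
    simp only [eval, cost, Polynomial.eval_add, Polynomial.eval_one, Polynomial.eval_finsetSum]
    simp only [List.length_tail] at h1
    omega
  | seq p q ihp ihq =>
    obtain ⟨t, h, ht⟩ := ihp ((le_max_left _ _).trans hD) C (hC.mono (le_max_left _ _)) S
    obtain ⟨t', h', ht'⟩ := ihq ((le_max_right _ _).trans hD) C (hC.mono (le_max_right _ _))
      (p.eval N S)
    refine ⟨t + t', Frag.exec_seq h h', ?_⟩
    simp only [eval, cost, Polynomial.eval_add]
    omega
  | clear k =>
    refine ⟨_, (Frag.exec_clear _ _).cast rfl (by simp only [eval, Sum.update_elim_inl]), ?_⟩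
    have := sum_length_update S k []
    simp [eval, cost] at this ⊢
    omega
  | loop p ih =>
    have hlt : p.depth < D := hD
    obtain ⟨hCf, hCt⟩ := hC p.depth (Nat.lt_succ_self _)
    -- Loops inside `p` have smaller depth and hence other control stacks; loops of equal depth are
    -- never nested and can share theirs.
    have hne (i) (hi : i < p.depth) : lev i ≠ lev p.depth := fun h =>
      hi.ne (hlev (Set.mem_Iic.2 (hi.trans hlt).le) (Set.mem_Iic.2 hlt.le) h)
    -- Here `m` iterations remain and `q` are done: units popped from one control stack are
    -- collected on the other, so that the counter can be restored.
    let C' (m q : ℕ) : L × Bool → List A :=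
      update (update C (lev p.depth, false) (List.replicate m a₀)) (lev p.depth, true)
        (List.replicate q a₀)
    have hC' (m q) : Ready lev N p.depth a₀ (C' m q) := fun i hi => by
      simpa [C', hne i hi] using hC i (hi.trans (Nat.lt_succ_self _))
    have key (m : ℕ) : ∀ q S, ∃ t,
        (Frag.whilePop (.inr (lev p.depth, false)) fun a =>
          (Frag.push (.inr (lev p.depth, true)) a).seq (p.compile lev)).Exec
          (Sum.elim S (C' m q)) t (Sum.elim ((p.eval N)^[m] S) (C' 0 (m + q))) ∧
        t + ∑ k, ((p.eval N)^[m] S k).length ≤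
          ∑ k, (S k).length + m * (p.cost.eval N + 2) + 1 := by
      induction m with
      | zero =>
        intro q S
        refine ⟨1, (Frag.exec_whilePop_nil ?_).cast rfl (by simp), by simp [add_comm]⟩
        simp [C']
      | succ m ihm =>
        intro q S
        obtain ⟨t, h, ht⟩ := ih hlt.le (C' m (q + 1)) (hC' _ _) S
        obtain ⟨t', h', ht'⟩ := ihm (q + 1) (p.eval N S)
        have h0 : Sum.elim S (C' (m + 1) q) (.inr (lev p.depth, false)) =
            a₀ :: List.replicate m a₀ := by simp [C', List.replicate_succ]
        refine ⟨1 + t + t' + 1, ?_, ?_⟩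
        · refine (Frag.exec_whilePop_cons h0 (Frag.exec_seq (Frag.exec_push _ _ _)
            (h.cast rfl rfl |> fun h => ?_)) h').cast rfl (by rw [add_assoc, add_comm 1 q]; rfl)
          convert h using 1
          rw [Sum.update_elim_inr, Sum.update_elim_inr]
          congr 1
          funext x
          by_cases hx : x = (lev p.depth, true)
          · subst hx; simp [C', List.replicate_succ]
          · by_cases hy : x = (lev p.depth, false) <;> simp [C', hx, hy]
        · rw [iterate_succ_apply, Nat.succ_mul]
          omega
    obtain ⟨t, h, ht⟩ := key N 0 S
    have e1 : C' N 0 = C := by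
      funext x
      by_cases hx : x = (lev p.depth, true)
      · subst hx; simp [C', hCt]
      · by_cases hy : x = (lev p.depth, false)
        · subst hy; simp [C', hCf]
        · simp [C', hx, hy]
    rw [e1] at h
    -- Restoring the counter takes `2 * N + 1` steps. With two bookkeeping steps per iteration this
    -- explains the `4` in `cost`.
    have hm := Frag.exec_move (k := (.inr (lev p.depth, true) : K ⊕ L × Bool))
      (k' := .inr (lev p.depth, false)) (by simp) (Sum.elim ((p.eval N)^[N] S) (C' 0 (N + 0)))
    refine ⟨_, Frag.exec_seq h (hm.cast rfl ?_), ?_⟩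
    · rw [Sum.update_elim_inr, Sum.update_elim_inr]
      congr 1
      funext x
      by_cases hy : x = (lev p.depth, false)
      · subst hy; simp [C', hCf]
      · by_cases hx : x = (lev p.depth, true)
        · subst hx; simp [C', hCt]
        · simp [C', hx, hy]
    · simp only [eval, cost, Polynomial.eval_add, Polynomial.eval_mul, Polynomial.eval_X,
        Polynomial.eval_ofNat, Sum.elim_inr, C', update_self, List.length_replicate]
      nlinarith [ht]

end Prog

/-! ### Initializing the loop counters. -/

section Startup

variable {K L A : Type} [DecidableEq K] [DecidableEq L] [Fintype L] [Fintype A]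

/-- The fragment that fills the counters of the loops with as many letters as the input has. -/
noncomputable def startup (inp tmp : K) (a₀ : A) : Frag (K ⊕ L × Bool) A :=
  .seq
    (.whilePop (.inl inp) fun a => (Frag.push (.inl tmp) a).seq
      (.pushAll a₀ (Finset.univ.toList.map fun l : L => .inr (l, false))))
    (.whilePop (.inl tmp) fun a => .push (.inl inp) a)

/-- While the input is moved to `tmp`, each letter adds one unit to every counter; moving it back
undoes the reversal. The two phases take `x.length * (Fintype.card L + 2) + 1` and `2 * x.length +
1` steps. -/
theorem exec_startup {inp tmp : K} (hne : inp ≠ tmp) (a₀ : A) (x : List A) :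
    (startup (L := L) inp tmp a₀).Exec (update (fun _ => []) (.inl inp) x)
      (x.length * (Fintype.card L + 4) + 2)
      (Sum.elim (update (fun _ => []) inp x)
        fun c => if c.2 then [] else List.replicate x.length a₀) := by
  let T (x y : List A) (m : ℕ) : K ⊕ L × Bool → List A :=
    Sum.elim (update (update (fun _ => []) inp x) tmp y)
      fun c => if c.2 then [] else List.replicate m a₀
  have h1 (x : List A) : ∀ y m,
      (Frag.whilePop (.inl inp) fun a => (Frag.push (.inl tmp) a).seq
        (.pushAll a₀ (Finset.univ.toList.map fun l : L => .inr (l, false)))).Exec (T x y m)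
        (x.length * (Fintype.card L + 2) + 1) (T [] (x.reverse ++ y) (x.length + m)) := by
    induction x with
    | nil =>
      intro y m
      exact (Frag.exec_whilePop_nil (by simp [-Sum.update_elim_inl, -Sum.update_elim_inr, T, hne])).cast (by simp) (by simp)
    | cons a x ih =>
      intro y m
      have hnd : (Finset.univ.toList.map fun l : L => (.inr (l, false) : K ⊕ L × Bool)).Nodup :=
        (Finset.nodup_toList _).map fun _ _ h => by simpa using h
      have h0 : T (a :: x) y m (.inl inp) = a :: x := by simp [-Sum.update_elim_inl, -Sum.update_elim_inr, T, hne]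
      refine (Frag.exec_whilePop_cons h0 ((Frag.exec_seq (Frag.exec_push _ _ _)
        (Frag.exec_pushAll a₀ _ hnd _)).cast rfl ?_) (ih (a :: y) (m + 1))).cast ?_ ?_
      · funext k
        rcases k with k | ⟨l, b⟩
        · by_cases hk : k = tmp
          · subst hk; simp [-Sum.update_elim_inl, -Sum.update_elim_inr, T, hne.symm]
          · by_cases hk' : k = inp
            · subst hk'; simp [-Sum.update_elim_inl, -Sum.update_elim_inr, T, hk]
            · simp [-Sum.update_elim_inl, -Sum.update_elim_inr, T, hk, hk']
        · cases b <;> simp [-Sum.update_elim_inl, -Sum.update_elim_inr, T, List.replicate_succ]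
      · simp
        ring
      · simp [add_assoc, add_comm 1 m]
  have h2 := Frag.exec_move (k := (.inl tmp : K ⊕ L × Bool)) (k' := .inl inp) (by simpa using hne.symm)
    (T [] (x.reverse ++ []) (x.length + 0))
  have h3 : T x [] 0 = update (fun _ => []) (.inl inp) x := by
    funext k
    rcases k with k | ⟨l, b⟩
    · by_cases hk : k = tmp
      · subst hk; simp [-Sum.update_elim_inl, -Sum.update_elim_inr, T, hne.symm]
      · by_cases hk' : k = inp
        · subst hk'; simp [-Sum.update_elim_inl, -Sum.update_elim_inr, T, hk]
        · simp [-Sum.update_elim_inl, -Sum.update_elim_inr, T, hk, hk']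
    · simp [-Sum.update_elim_inl, -Sum.update_elim_inr, T]
  have h4 := h1 x [] 0
  rw [h3] at h4
  refine (Frag.exec_seq h4 h2).cast ?_ ?_
  · simp [-Sum.update_elim_inl, -Sum.update_elim_inr, T]
    ring
  · funext k
    rcases k with k | ⟨l, b⟩
    · by_cases hk : k = inp
      · subst hk; simp [-Sum.update_elim_inl, -Sum.update_elim_inr, T, hne]
      · by_cases hk' : k = tmp
        · subst hk'; simp [hk]
        · simp [-Sum.update_elim_inl, -Sum.update_elim_inr, T, hk, hk']
    · simp [-Sum.update_elim_inl, -Sum.update_elim_inr, T]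

end Startup

/-- The final erasure of all stacks but `ans` is paid for by the potential left over in
`exec_compile`, plus the contents of the control stacks, which are linear in the input length. -/
theorem solvableInPolyTime_of_prog {K : Type} [DecidableEq K] [Fintype K] {α : Type}
    {enc : α → List Γ'} {P : α → Prop} (f : α → Bool) (hf : ∀ a, f a = true ↔ P a)
    (p : Prog K Γ') {inp tmp ans : K} (hne : inp ≠ tmp)
    (h : ∀ a, p.eval (enc a).length (update (fun _ => []) inp (enc a)) ans = [Γ'.bit (f a)]) :
    SolvableInPolyTime enc P := by
  let D := p.depth
  let L := Fin (D + 1)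
  let lev : ℕ → L := Fin.ofNat (D + 1)
  have hlev : Set.InjOn lev (Set.Iic D) := fun i hi j hj hij => by
    have := congrArg Fin.val hij
    simpa [lev, Nat.mod_eq_of_lt (Nat.lt_succ_of_le hi), Nat.mod_eq_of_lt (Nat.lt_succ_of_le hj)]
      using this
  let ks : List (K ⊕ L × Bool) := (Finset.univ.erase (.inl ans)).toList
  refine solvableInPolyTime_of_exec f hf
    ((startup (L := L) inp tmp Γ'.blank).seq ((p.compile lev).seq (.clearAll ks))) (.inl inp)
    (.inl ans)
    (.X * (.C (Fintype.card L + 4) + 1 + .C (Fintype.card (L × Bool))) + 2 + p.cost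
      + .C (Fintype.card (K ⊕ L × Bool))) fun a => ?_
  set N := (enc a).length
  set C : L × Bool → List Γ' := fun c => if c.2 then [] else List.replicate N Γ'.blank with hCdef
  have h1 := exec_startup (L := L) hne Γ'.blank (enc a)
  obtain ⟨t, h2, ht⟩ := p.exec_compile hlev N Γ'.blank le_rfl C (fun i _ => by simp [C])
    (update (fun _ => []) inp (enc a))
  set S' := p.eval N (update (fun _ => []) inp (enc a))
  obtain ⟨t', ht', h3⟩ := Frag.exec_clearAll ks (Sum.elim S' C)
  refine ⟨_, ?_, (Frag.exec_seq h1 (Frag.exec_seq h2 h3)).cast rfl ?_⟩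
  · have e1 : ∑ k, (update (fun _ => []) inp (enc a) k).length = N := by
      simpa using Prog.sum_length_update (fun _ => []) inp (enc a)
    have e2 : (ks.map fun k => (Sum.elim S' C k).length + 1).sum ≤
        ∑ k, (Sum.elim S' C k).length + Fintype.card (K ⊕ L × Bool) := by
      rw [Finset.sum_map_toList]
      refine (Finset.sum_le_univ_sum_of_nonneg fun _ => Nat.zero_le _).trans ?_
      simp [Finset.sum_add_distrib]
    have e3 : ∑ k, (Sum.elim S' C k).length ≤ ∑ k, (S' k).length + Fintype.card (L × Bool) * N := by
      rw [Fintype.sum_sum_type]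
      refine Nat.add_le_add_left ?_ _
      rw [← smul_eq_mul, ← Finset.card_univ]
      refine Finset.sum_le_card_nsmul _ _ _ fun c _ => ?_
      cases hc : c.2 <;> simp [C, hc]
    rw [e1] at ht
    simp only [Polynomial.eval_add, Polynomial.eval_mul, Polynomial.eval_X, Polynomial.eval_C,
      Polynomial.eval_one, Polynomial.eval_ofNat]
    nlinarith
  · funext k
    rcases k with k | c
    · by_cases hk : k = ans
      · subst hk; simp [ks, S', N, h]
      · simp [ks, hk]
    · simp [ks]

/-! ### Counters, relation tables and commands. -/

/-- The stacks of a machine with counters indexed by `V` and tables indexed by `R`. -/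
inductive Stk (V R : Type) where
  | inp
  | tmp
  | ans
  | cnt
  | buf
  | flag
  | ctr (v : V)
  | tab (r : R)
  deriving DecidableEq, Fintype

/-- Abstract states: the values of the counters, the relations stored in the tables, and the unread
input. -/
structure Abs (V R : Type) where
  /-- the values of the counters -/
  c : V → ℕ
  /-- the relations -/
  r : R → ℕ → ℕ → Prop
  /-- the unread input -/
  inp : List Γ'

/-- Commands that work on abstract states. -/
inductive Cmd (V R : Type) where
  | skip : Cmd V R
  | seq (p q : Cmd V R) : Cmd V R
  | inc (v : V) : Cmd V R
  | zero (v : V) : Cmd V R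
  | set (r : R) (v w : V) : Cmd V R
  | ite (r : R) (v w : V) (p q : Cmd V R) : Cmd V R
  | loop (p : Cmd V R) : Cmd V R
  | read (f : Option Γ' → Cmd V R) : Cmd V R

section act

variable {V R : Type} [DecidableEq V]

/-- Add a pair of numbers less than `M` to a relation. -/
def insertRel (M : ℕ) (ρ : R → ℕ → ℕ → Prop) (r : R) (i j : ℕ) : R → ℕ → ℕ → Prop :=
  fun r' i' j' => ρ r' i' j' ∨ (r' = r ∧ i' = i ∧ j' = j ∧ i < M ∧ j < M)

/-- A pair of numbers less than `M` is in a relation. -/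
def testRel (M : ℕ) (ρ : R → ℕ → ℕ → Prop) (r : R) (i j : ℕ) : Prop :=
  ρ r i j ∧ i < M ∧ j < M

open Classical in
/-- The effect of a command if loops are executed `M` times. -/
noncomputable def Cmd.act (M : ℕ) : Cmd V R → Abs V R → Abs V R
  | skip, s => s
  | seq p q, s => q.act M (p.act M s)
  | inc v, s => { s with c := update s.c v (s.c v + 1) }
  | zero v, s => { s with c := update s.c v 0 }
  | set r v w, s => { s with r := insertRel M s.r r (s.c v) (s.c w) }
  | ite r v w p q, s => if testRel M s.r r (s.c v) (s.c w) then p.act M s else q.act M s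
  | loop p, s => (p.act M)^[M] s
  | read f, s => (f s.inp.head?).act M { s with inp := s.inp.tail }

end act

section table

open Classical in
/-- The table of a relation on the numbers less than `M`, row by row. -/
noncomputable def table (M : ℕ) (ρ : ℕ → ℕ → Prop) : List Γ' :=
  (List.range (M * M)).map fun k => Γ'.bit (decide (ρ (k / M) (k % M)))

theorem length_table (M : ℕ) (ρ : ℕ → ℕ → Prop) : (table M ρ).length = M * M := by simp [table]

theorem mul_add_lt_mul {M i j : ℕ} (hi : i < M) (hj : j < M) : i * M + j < M * M := by
  calc i * M + j < i * M + M := by omega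
    _ = (i + 1) * M := by ring
    _ ≤ M * M := Nat.mul_le_mul_right _ hi

open Classical in
theorem getElem?_table {M : ℕ} (ρ : ℕ → ℕ → Prop) {i j : ℕ} (hi : i < M) (hj : j < M) :
    (table M ρ)[i * M + j]? = some (Γ'.bit (decide (ρ i j))) := by
  have hM : 0 < M := by omega
  have h1 : (i * M + j) / M = i := by
    rw [mul_comm, Nat.mul_add_div hM, Nat.div_eq_of_lt hj, add_zero]
  have h2 : (i * M + j) % M = j := by
    rw [mul_comm, Nat.mul_add_mod, Nat.mod_eq_of_lt hj]
  simp [table, List.getElem?_range (mul_add_lt_mul hi hj), h1, h2]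

theorem set_table {M : ℕ} (ρ : ℕ → ℕ → Prop) {i j : ℕ} (hi : i < M) (hj : j < M) :
    (table M ρ).set (i * M + j) (Γ'.bit true) =
      table M fun i' j' => ρ i' j' ∨ (i' = i ∧ j' = j) := by
  have hM : 0 < M := by omega
  refine List.ext_getElem (by simp [length_table]) fun k h1 h2 => ?_
  rw [length_table] at h2
  rw [List.getElem_set]
  simp only [table, List.getElem_map, List.getElem_range]
  have h3 : i * M + j = k ↔ k / M = i ∧ k % M = j := by
    constructor
    · rintro rfl
      exact ⟨by rw [mul_comm, Nat.mul_add_div hM, Nat.div_eq_of_lt hj, add_zero],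
        by rw [mul_comm, Nat.mul_add_mod, Nat.mod_eq_of_lt hj]⟩
    · rintro ⟨rfl, rfl⟩
      rw [mul_comm, Nat.div_add_mod]
  by_cases h : i * M + j = k
  · rw [if_pos h]
    simp [h3.1 h]
  · rw [if_neg h]
    simp [show ¬ (k / M = i ∧ k % M = j) from fun h' => h (h3.2 h')]

end table

/-! ### Random access to a table stored on a stack. -/

section comp

variable {V R : Type} [DecidableEq V] [DecidableEq R]

/-- The stacks with given counters and tables. -/
def stkOf (x : List Γ') (c : V → ℕ) (T : R → List Γ') (e : ℕ) (b f : List Γ') : Stk V R → List Γ'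
  | .inp => x
  | .tmp => []
  | .ans => []
  | .cnt => List.replicate e Γ'.blank
  | .buf => b
  | .flag => f
  | .ctr v => List.replicate (c v) Γ'.blank
  | .tab r => T r

variable (x : List Γ') (c : V → ℕ) (T : R → List Γ') (e : ℕ) (b f : List Γ')

@[simp]
theorem update_stkOf_inp (l : List Γ') :
    update (stkOf x c T e b f) .inp l = stkOf l c T e b f := by
  funext k; cases k <;> simp [stkOf]

@[simp]
theorem update_stkOf_cnt (n : ℕ) :
    update (stkOf x c T e b f) .cnt (List.replicate n Γ'.blank) = stkOf x c T n b f := by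
  funext k; cases k <;> simp [stkOf]

@[simp]
theorem update_stkOf_buf (l : List Γ') :
    update (stkOf x c T e b f) .buf l = stkOf x c T e l f := by
  funext k; cases k <;> simp [stkOf]

@[simp]
theorem update_stkOf_flag (l : List Γ') :
    update (stkOf x c T e b f) .flag l = stkOf x c T e b l := by
  funext k; cases k <;> simp [stkOf]

@[simp]
theorem update_stkOf_ctr (v : V) (n : ℕ) :
    update (stkOf x c T e b f) (.ctr v) (List.replicate n Γ'.blank) =
      stkOf x (update c v n) T e b f := by
  funext k
  cases k with
  | ctr w => by_cases h : w = v <;> simp [stkOf, h]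
  | _ => simp [stkOf]

@[simp]
theorem update_stkOf_tab (r : R) (l : List Γ') :
    update (stkOf x c T e b f) (.tab r) l = stkOf x c (update T r l) e b f := by
  funext k
  cases k with
  | tab w => by_cases h : w = r <;> simp [stkOf, h]
  | _ => simp [stkOf]

namespace Prog

variable {K : Type} [DecidableEq K]

/-- Move a letter from one stack to another. -/
def move (k k' : K) : Prog K Γ' := pop k fun o => o.elim skip fun a => push k' a

/-- Execute a program once more than in a loop. -/
def many (p : Prog K Γ') : Prog K Γ' := seq (loop p) p

theorem eval_many (N : ℕ) (p : Prog K Γ') (S : K → List Γ') :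
    (many p).eval N S = (p.eval N)^[N + 1] S := by
  rw [iterate_succ_apply']
  rfl

theorem iterate_eval_move (N : ℕ) {k k' : K} (hk : k ≠ k') (m : ℕ) (S : K → List Γ') :
    ((move k k').eval N)^[m] S =
      update (update S k ((S k).drop m)) k' (((S k).take m).reverse ++ S k') := by
  induction m generalizing S with
  | zero => simp
  | succ m ih =>
    rw [iterate_succ_apply, ih]
    cases hl : S k with
    | nil =>
      have : (move k k').eval N S = S := by
        simp only [move, eval, hl, List.head?_nil, Option.elim_none, List.tail_nil]
        rw [← hl, update_eq_self]
      simp [this, hl]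
    | cons a l =>
      have : (move k k').eval N S = update (update S k l) k' (a :: S k') := by
        simp [move, eval, hl, hk.symm]
      rw [this]
      funext j
      by_cases h1 : j = k'
      · subst h1; simp [hk]
      · by_cases h2 : j = k
        · subst h2; simp [h1]
        · simp [h1, h2]

/-- Execute `q` if a counter is positive, after moving one unit of it to the stack `cnt`. -/
def walk (v : V) (q : Prog (Stk V R) Γ') : Prog (Stk V R) Γ' :=
  pop (.ctr v) fun o => o.elim skip fun a => seq (push .cnt a) q

/-- Once the counter is exhausted, further rounds do nothing. So a loop of fixed length simulates
one of length `c v`, which is where `min m (c v)` comes from. -/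
theorem iterate_eval_walk (N d : ℕ) (r : R) (v : V) (q : Prog (Stk V R) Γ')
    (hq : ∀ c T e b, q.eval N (stkOf x c T e b f) =
      stkOf x c (update T r ((T r).drop d)) e (((T r).take d).reverse ++ b) f) (m : ℕ) :
    ((walk v q).eval N)^[m] (stkOf x c T e b f) =
      stkOf x (update c v (c v - m)) (update T r ((T r).drop (min m (c v) * d)))
        (e + min m (c v)) (((T r).take (min m (c v) * d)).reverse ++ b) f := by
  induction m generalizing c T e b with
  | zero => simp
  | succ m ih =>
    rw [iterate_succ_apply]
    cases hn : c v with
    | zero =>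
      have : (walk v q).eval N (stkOf x c T e b f) = stkOf x c T e b f := by
        have h := update_stkOf_ctr x c T e b f v 0
        rw [← hn, update_eq_self, hn] at h
        simp only [walk, eval, stkOf, hn, List.replicate_zero, List.head?_nil, Option.elim_none,
          List.tail_nil]
        exact h
      rw [this, ih, hn]
      simp
    | succ n =>
      have : (walk v q).eval N (stkOf x c T e b f) =
          q.eval N (stkOf x (update c v n) T (e + 1) b f) := by
        simp only [walk, eval, stkOf, hn, List.replicate_succ, List.head?_cons, Option.elim_some,
          List.tail_cons]
        rw [update_stkOf_ctr]
        exact congrArg _ (update_stkOf_cnt x (update c v n) T e b f (e + 1))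
      rw [this, hq, ih]
      simp only [update_self, update_idem, List.drop_drop, Nat.succ_min_succ]
      congr 1
      · simp
      · rw [Nat.succ_mul, add_comm]
      · omega
      · rw [← List.append_assoc, ← List.reverse_append, Nat.succ_mul, add_comm _ d, List.take_add]

/-- Execute `body` when the part of the table of `r` before the entry with indices given by the
counters `v` and `w` is removed. Nothing is done if an index is too large. -/
def access (r : R) (v w : V) (body : Prog (Stk V R) Γ') : Prog (Stk V R) Γ' :=
  seq (many (walk v (many (move (.tab r) .buf)))) <|
  seq (many (move .cnt (.ctr v))) <|
  seq (loop (walk w (move (.tab r) .buf))) <|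
  seq (pop (.ctr w) fun o => o.elim body fun a => push (.ctr w) a) <|
  seq (many (move .cnt (.ctr w))) (many (many (move .buf (.tab r))))

theorem iterate_move_tab_buf (N d : ℕ) (r : R) :
    ((move (.tab r) .buf).eval N)^[d] (stkOf x c T e b f) =
      stkOf x c (update T r ((T r).drop d)) e (((T r).take d).reverse ++ b) f := by
  rw [iterate_eval_move N (by simp)]
  simp [stkOf]

theorem iterate_move_buf_tab (N d : ℕ) (r : R) :
    ((move .buf (.tab r)).eval N)^[d] (stkOf x c T e b f) =
      stkOf x c (update T r ((b.take d).reverse ++ T r)) e (b.drop d) f := by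
  rw [iterate_eval_move N (by simp)]
  simp [stkOf]

theorem iterate_move_cnt_ctr (N d : ℕ) (v : V) :
    ((move .cnt (.ctr v)).eval N)^[d] (stkOf x c T e b f) =
      stkOf x (update c v (min d e + c v)) T (e - d) b f := by
  rw [iterate_eval_move N (by simp)]
  simp [stkOf]

theorem eval_many_many (N : ℕ) (p : Prog K Γ') (S : K → List Γ') :
    (many (many p)).eval N S = (p.eval N)^[(N + 1) * (N + 1)] S := by
  rw [eval_many, show (many p).eval N = (p.eval N)^[N + 1] from funext (eval_many N p),
    ← iterate_mul]

/-- The row index `v` shifts whole rows of `N + 1` entries to `buf`, the column index `w` shifts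
single entries; then `body` sees the wanted entry on top. Counters are parked on `cnt` and the table
prefix on `buf`, and both are put back. The conditions on `g` and `h` make `body` harmless on an
empty table. -/
theorem eval_access (N : ℕ) (r : R) (v w : V) (body : Prog (Stk V R) Γ')
    (g : List Γ' → List Γ') (h : List Γ' → List Γ')
    (hbody : ∀ c T e b, body.eval N (stkOf x c T e b []) =
      stkOf x c (update T r (g (T r))) e b (h (T r)))
    (hg : ∀ l, (g l).length = l.length) (hh : h [] = []) (hT : (T r).length = (N + 1) * (N + 1)) :
    (access r v w body).eval N (stkOf x c T 0 [] []) =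
      if c v < N + 1 ∧ c w < N + 1 then
        stkOf x c (update T r ((T r).take (c v * (N + 1) + c w) ++
          g ((T r).drop (c v * (N + 1) + c w)))) 0 [] (h ((T r).drop (c v * (N + 1) + c w)))
      else stkOf x c T 0 [] [] := by
  set A := min (N + 1) (c v) * (N + 1) + min N (c w) with hA
  have h1 : (seq (many (walk v (many (move (.tab r) .buf)))) <|
      seq (many (move .cnt (.ctr v))) (loop (walk w (move (.tab r) .buf)))).eval N
        (stkOf x c T 0 [] []) =
      stkOf x (update c w (c w - N)) (update T r ((T r).drop A)) (min N (c w))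
        ((T r).take A).reverse [] := by
    simp only [eval, eval_many]
    rw [iterate_eval_walk (r := r) (d := N + 1) (hq := fun c T e b => by
        rw [eval_many, iterate_move_tab_buf]),
      iterate_move_cnt_ctr,
      iterate_eval_walk (r := r) (d := 1) (hq := fun c T e b => by
        simpa using iterate_move_tab_buf x c T e b [] N 1 r)]
    have hc : update (update c v (c v - (N + 1))) v
        (min (N + 1) (0 + min (N + 1) (c v)) + update c v (c v - (N + 1)) v) = c := by
      rw [update_idem, update_eq_self_iff, update_self]
      omega
    rw [hc]
    simp only [update_self, update_idem, List.drop_drop, mul_one]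
    congr 1
    · omega
    · rw [hA, List.take_add, List.reverse_append]
      simp
  have h2 (b' : List Γ') (hb' : ((T r).take A).length + b'.length = (N + 1) * (N + 1)) (f' : List Γ') :
      (seq (many (move .cnt (.ctr w))) (many (many (move .buf (.tab r))))).eval N
        (stkOf x (update c w (c w - N)) (update T r b') (min N (c w)) ((T r).take A).reverse f') =
      stkOf x c (update T r ((T r).take A ++ b')) 0 [] f' := by
    simp only [eval, eval_many_many]
    rw [eval_many, iterate_move_cnt_ctr, iterate_move_buf_tab]
    congr 1
    · rw [update_idem, update_eq_self_iff, update_self]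
      omega
    · rw [List.take_of_length_le (by simp only [List.length_reverse]; omega), update_idem, update_self,
        List.reverse_reverse]
    · omega
    · rw [List.drop_of_length_le (by simp only [List.length_reverse]; omega)]
  have h3 : (access r v w body).eval N (stkOf x c T 0 [] []) =
      (seq (many (move .cnt (.ctr w))) (many (many (move .buf (.tab r))))).eval N
        ((pop (.ctr w) fun o => o.elim body fun a => push (.ctr w) a).eval N
          (stkOf x (update c w (c w - N)) (update T r ((T r).drop A)) (min N (c w))
            ((T r).take A).reverse [])) := by
    rw [← h1]
    rfl
  rw [h3]
  have hlen : ((T r).take A).length + ((T r).drop A).length = (N + 1) * (N + 1) := by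
    rw [← List.length_append, List.take_append_drop, hT]
  -- The column walk has `N` rounds, not `N + 1`, so the counter is empty afterwards exactly for the
  -- valid columns `0, …, N`.
  by_cases hw : c w < N + 1
  · have e1 : (pop (.ctr w) fun o => o.elim body fun a => push (.ctr w) a).eval N
          (stkOf x (update c w (c w - N)) (update T r ((T r).drop A)) (min N (c w))
            ((T r).take A).reverse []) =
        body.eval N (stkOf x (update c w (c w - N)) (update T r ((T r).drop A)) (min N (c w))
            ((T r).take A).reverse []) := by
      have h0 : c w - N = 0 := by omega
      have := update_stkOf_ctr x (update c w 0) (update T r ((T r).drop A)) (min N (c w))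
            ((T r).take A).reverse [] w 0
      rw [update_idem] at this
      simp only [eval, stkOf, update_self, h0, List.replicate_zero, List.head?_nil,
        Option.elim_none, List.tail_nil]
      exact congrArg _ this
    rw [e1, hbody, update_self, update_idem]
    by_cases hv : c v < N + 1
    · have hA' : A = c v * (N + 1) + c w := by
        rw [hA, min_eq_right hv.le, min_eq_right (by omega)]
      rw [if_pos ⟨hv, hw⟩, ← hA']
      exact h2 _ (by rw [hg, hlen]) _
    -- With too large a row index the whole table is on `buf`, and `body` acts on the empty list.
    · have hA' : (N + 1) * (N + 1) ≤ A := by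
        rw [hA, min_eq_left (by omega)]
        omega
      have hd : (T r).drop A = [] := List.drop_of_length_le (hT.trans_le hA')
      have hg0 : g [] = [] := List.length_eq_zero_iff.1 (hg [])
      rw [if_neg fun h => hv h.1, hd, hg0, hh, h2 [] (by rw [← hlen, hd]),
        List.append_nil, List.take_of_length_le (hT.trans_le hA'), update_eq_self]
  · have e1 : (pop (.ctr w) fun o => o.elim body fun a => push (.ctr w) a).eval N
          (stkOf x (update c w (c w - N)) (update T r ((T r).drop A)) (min N (c w))
            ((T r).take A).reverse []) =
        stkOf x (update c w (c w - N)) (update T r ((T r).drop A)) (min N (c w))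
            ((T r).take A).reverse [] := by
      obtain ⟨n, hn⟩ : ∃ n, c w - N = n + 1 := ⟨c w - N - 1, by omega⟩
      simp [eval, stkOf, hn, List.replicate_succ]
      have := update_stkOf_ctr x (update c w n) (update T r ((T r).drop A)) (min N (c w))
            ((T r).take A).reverse [] w (n + 1)
      rw [update_idem] at this
      exact this
    rw [if_neg fun h => hw h.2, e1, h2 _ hlen, List.take_append_drop, update_eq_self]

end Prog

end comp

/-! ### Compiling commands to programs. -/

section comp

variable {V R : Type} [DecidableEq V] [DecidableEq R]

namespace Prog

/-- Set an entry of a table. -/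
def setEntry (r : R) (v w : V) : Prog (Stk V R) Γ' :=
  access r v w (pop (.tab r) fun o => o.elim skip fun _ => push (.tab r) (Γ'.bit true))

/-- Push a letter to the stack `flag` if an entry of a table is set. -/
def testEntry (r : R) (v w : V) : Prog (Stk V R) Γ' :=
  access r v w (pop (.tab r) fun o => o.elim skip fun a => seq (push (.tab r) a)
    (if a = Γ'.bit true then push .flag a else skip))

theorem eval_setEntry (N : ℕ) (x : List Γ') (c : V → ℕ) (ρ : R → ℕ → ℕ → Prop) (r : R) (v w : V) :
    (setEntry r v w).eval N (stkOf x c (fun r => table (N + 1) (ρ r)) 0 [] []) =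
      stkOf x c (fun r' => table (N + 1) (insertRel (N + 1) ρ r (c v) (c w) r')) 0 [] [] := by
  unfold setEntry
  rw [eval_access (T := fun r => table (N + 1) (ρ r)) (g := fun l => l.set 0 (Γ'.bit true)) (h := fun _ => [])
    (hg := fun l => by simp) (hh := rfl) (hT := length_table _ _)]
  · split_ifs with h
    · congr 1
      funext r'
      by_cases hr : r' = r
      · subst hr
        rw [update_self]
        have h1 := set_table (ρ r') h.1 h.2
        rw [← List.take_append_drop (c v * (N + 1) + c w) (table (N + 1) (ρ r')),
          List.set_append_right _ _ (List.length_take_le _ _), List.length_take_of_le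
            ((length_table _ _).symm ▸ (mul_add_lt_mul h.1 h.2).le), Nat.sub_self] at h1
        rw [h1]
        congr 1
        funext i j
        simp [insertRel, h]
      · rw [update_of_ne hr]
        congr 1
        funext i j
        simp [insertRel, hr]
    · congr 1
      funext r'
      congr 1
      funext i j
      simp only [insertRel, eq_iff_iff]
      tauto
  · intro c T e b
    cases hl : T r with
    | nil =>
      have := update_stkOf_tab x c T e b [] r []
      simp only [eval, stkOf, hl, List.head?_nil, Option.elim_none, List.tail_nil, List.set_nil]
      exact this
    | cons a l => simp [eval, stkOf, hl]

theorem eval_testEntry (N : ℕ) (x : List Γ') (c : V → ℕ) (ρ : R → ℕ → ℕ → Prop) (r : R) (v w : V) :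
    (testRel (N + 1) ρ r (c v) (c w) ∧
      (testEntry r v w).eval N (stkOf x c (fun r => table (N + 1) (ρ r)) 0 [] []) =
        stkOf x c (fun r => table (N + 1) (ρ r)) 0 [] [Γ'.bit true]) ∨
    (¬ testRel (N + 1) ρ r (c v) (c w) ∧
      (testEntry r v w).eval N (stkOf x c (fun r => table (N + 1) (ρ r)) 0 [] []) =
        stkOf x c (fun r => table (N + 1) (ρ r)) 0 [] []) := by
  classical
  unfold testEntry
  rw [eval_access (T := fun r => table (N + 1) (ρ r)) (g := id)
    (h := fun l => if l.head? = some (Γ'.bit true) then [Γ'.bit true] else [])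
    (hg := fun l => rfl) (hh := rfl) (hT := length_table _ _)]
  · rw [id, List.take_append_drop, update_eq_self, List.head?_drop]
    by_cases h : c v < N + 1 ∧ c w < N + 1
    · rw [if_pos h, getElem?_table _ h.1 h.2]
      by_cases hρ : ρ r (c v) (c w)
      · exact .inl ⟨⟨hρ, h⟩, by simp [hρ]⟩
      · exact .inr ⟨fun h' => hρ h'.1, by simp [hρ]⟩
    · rw [if_neg h]
      exact .inr ⟨fun h' => h h'.2, rfl⟩
  · intro c T e b
    cases hl : T r with
    | nil =>
      have := update_stkOf_tab x c T e b [] r []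
      simp only [eval, stkOf, hl, List.head?_nil, Option.elim_none, List.tail_nil, id]
      exact this
    | cons a l =>
      have := update_stkOf_tab x c T e b [] r (a :: l)
      by_cases ha : a = Γ'.bit true
      · subst ha
        simp [eval, stkOf, hl]
      · simp [eval, stkOf, hl, ha]

/-- Fill tables with zeros. -/
def zeroTables : List R → Prog (Stk V R) Γ'
  | [] => skip
  | r :: rs => seq (many (many (push (.tab r) (Γ'.bit false)))) (zeroTables rs)

theorem eval_zeroTables (N : ℕ) (x : List Γ') (c : V → ℕ) (rs : List R) (hrs : rs.Nodup)
    (T : R → List Γ') (hT : ∀ r ∈ rs, T r = []) :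
    (zeroTables rs).eval N (stkOf x c T 0 [] []) =
      stkOf x c (fun r => if r ∈ rs then table (N + 1) (fun _ _ => False) else T r) 0 [] [] := by
  induction rs generalizing T with
  | nil => simp [zeroTables, eval]
  | cons r rs ih =>
    rw [List.nodup_cons] at hrs
    have h1 (m : ℕ) : ((push (.tab r) (Γ'.bit false)).eval N)^[m] (stkOf x c T 0 [] []) =
        stkOf x c (update T r (List.replicate m (Γ'.bit false))) 0 [] [] := by
      induction m with
      | zero => simp [← hT r]
      | succ m ihm =>
        rw [iterate_succ_apply', ihm]
        simp [eval, stkOf, List.replicate_succ]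
    have h2 : table (N + 1) (fun _ _ => False) =
        List.replicate ((N + 1) * (N + 1)) (Γ'.bit false) := by
      simp [table, List.map_const']
    change (zeroTables rs).eval N ((many (many (push (.tab r) (Γ'.bit false)))).eval N _) = _
    rw [eval_many_many, h1, ← h2, ih hrs.2]
    · congr 1
      funext r'
      by_cases h : r' = r
      · subst h; simp [hrs.1]
      · simp [h]
    · intro r' hr'
      rw [update_of_ne (ne_of_mem_of_not_mem hr' hrs.1), hT r' (by simp [hr'])]

end Prog

open Prog in
/-- The program for a command. -/
def Cmd.comp : Cmd V R → Prog (Stk V R) Γ'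
  | skip => .skip
  | seq p q => .seq p.comp q.comp
  | inc v => .push (.ctr v) Γ'.blank
  | zero v => .clear (.ctr v)
  | set r v w => setEntry r v w
  | ite r v w p q => .seq (testEntry r v w) (.pop .flag fun o => if o.isSome then p.comp else q.comp)
  | loop p => many p.comp
  | read f => .pop .inp fun o => (f o).comp

/-- The stacks that represent an abstract state. -/
noncomputable def Abs.stk (N : ℕ) (s : Abs V R) : Stk V R → List Γ' :=
  stkOf s.inp s.c (fun r => table (N + 1) (s.r r)) 0 [] []

/-- Every command commutes with the representation of states by stacks. Loops of commands become
`many`, so they run `N + 1` times, matching the side length of the tables. -/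
theorem Cmd.eval_comp (N : ℕ) (p : Cmd V R) (s : Abs V R) :
    p.comp.eval N (s.stk N) = (p.act (N + 1) s).stk N := by
  induction p generalizing s with
  | skip => rfl
  | seq p q ihp ihq => simp only [comp, Prog.eval, act, ihp, ihq]
  | inc v => exact update_stkOf_ctr (v := v) (n := s.c v + 1) ..
  | zero v => exact update_stkOf_ctr (v := v) (n := 0) ..
  | set r v w => exact Prog.eval_setEntry ..
  | ite r v w p q ihp ihq =>
    simp only [comp, Prog.eval, act, Abs.stk]
    rcases Prog.eval_testEntry N s.inp s.c s.r r v w with ⟨h, h1⟩ | ⟨h, h1⟩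
    · rw [h1, if_pos h]
      refine Eq.trans ?_ (ihp s)
      simp [stkOf, Abs.stk]
    · rw [h1, if_neg h]
      refine Eq.trans ?_ (ihq s)
      have := update_stkOf_flag s.inp s.c (fun r => table (N + 1) (s.r r)) 0 [] [] []
      simp only [stkOf, List.head?_nil, Option.isSome_none, Bool.false_eq_true, if_false,
        List.tail_nil]
      rw [this]
      rfl
  | loop p ih =>
    simp only [comp, Prog.eval_many, act]
    exact (Semiconj.iterate_right (f := Abs.stk N) (fun s => (ih s).symm) (N + 1) s).symm
  | read f ih =>
    simp only [comp, act]
    rw [← ih]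
    exact congrArg _ (update_stkOf_inp ..)

/-- The entry that is tested certifies negative instances, hence the answer is `o.isNone`. The `+ 1`
keeps index `0` valid even for the empty input. -/
theorem solvableInPolyTime_of_cmd [Fintype V] [Fintype R] {α : Type} {enc : α → List Γ'}
    {P : α → Prop} (p : Cmd V R) (r : R) (v : V)
    (h : ∀ a, P a ↔ ¬ testRel ((enc a).length + 1)
      (p.act ((enc a).length + 1) ⟨fun _ => 0, fun _ _ _ => False, enc a⟩).r r
      ((p.act ((enc a).length + 1) ⟨fun _ => 0, fun _ _ _ => False, enc a⟩).c v)
      ((p.act ((enc a).length + 1) ⟨fun _ => 0, fun _ _ _ => False, enc a⟩).c v)) :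
    SolvableInPolyTime enc P := by
  classical
  refine solvableInPolyTime_of_prog (K := Stk V R) (fun a => decide (P a)) (fun a => by simp)
    (.seq (.zeroTables Finset.univ.toList) <| .seq p.comp <| .seq (.testEntry r v v) <|
      .pop .flag fun o => .push .ans (Γ'.bit o.isNone)) (inp := .inp) (tmp := .tmp) (ans := .ans)
    (by simp) fun a => ?_
  specialize h a
  set N := (enc a).length
  have h0 : update (fun _ => []) Stk.inp (enc a) =
      stkOf (V := V) (R := R) (enc a) (fun _ => 0) (fun _ => []) 0 [] [] := by
    funext k; cases k <;> simp [stkOf]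
  have h1 : (Prog.zeroTables Finset.univ.toList).eval N
      (update (fun _ => []) Stk.inp (enc a)) =
      (⟨fun _ => 0, fun _ _ _ => False, enc a⟩ : Abs V R).stk N := by
    rw [h0, Prog.eval_zeroTables _ _ _ _ (Finset.nodup_toList _) _ (by simp)]
    simp [Abs.stk]
  simp only [Prog.eval]
  rw [h1, Cmd.eval_comp]
  set s := p.act (N + 1) ⟨fun _ => 0, fun _ _ _ => False, enc a⟩
  unfold Abs.stk
  rcases Prog.eval_testEntry N s.inp s.c s.r r v v with ⟨h2, h3⟩ | ⟨h2, h3⟩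
  · rw [h3]
    have : ¬ P a := fun hP => h.1 hP h2
    simp [stkOf, this]
  · rw [h3]
    simp [stkOf, h.2 h2]

end comp

variable {V R : Type}

/-! ### Quantifier-free formulas as branching conditions. -/

/-- Quantifier-free formulas about the relations and the values of the counters. -/
inductive Form (V R : Type) where
  | rel (r : R) (v w : V) : Form V R
  | not (f : Form V R) : Form V R
  | and (f g : Form V R) : Form V R
  | or (f g : Form V R) : Form V R

namespace Form

/-- The truth of a formula. -/
def Holds (M : ℕ) (ρ : R → ℕ → ℕ → Prop) (τ : V → ℕ) : Form V R → Prop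
  | rel r v w => testRel M ρ r (τ v) (τ w)
  | not f => ¬ f.Holds M ρ τ
  | and f g => f.Holds M ρ τ ∧ g.Holds M ρ τ
  | or f g => f.Holds M ρ τ ∨ g.Holds M ρ τ

/-- The relation `r` does not occur in a formula. -/
def Free (r : R) : Form V R → Prop
  | rel r' _ _ => r' ≠ r
  | not f => f.Free r
  | and f g => f.Free r ∧ g.Free r
  | or f g => f.Free r ∧ g.Free r

theorem Free.holds_congr {r : R} {f : Form V R} (h : f.Free r) {M : ℕ} {ρ ρ' : R → ℕ → ℕ → Prop}
    (hρ : ∀ r' ≠ r, ρ r' = ρ' r') (τ : V → ℕ) : f.Holds M ρ τ ↔ f.Holds M ρ' τ := by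
  induction f with
  | rel r' v w => simp only [Holds, testRel, hρ r' h]
  | not f ih => exact not_congr (ih h)
  | and f g ihf ihg => exact and_congr (ihf h.1) (ihg h.2)
  | or f g ihf ihg => exact or_congr (ihf h.1) (ihg h.2)

/-- Branch on the truth of a formula. -/
def ite : Form V R → Cmd V R → Cmd V R → Cmd V R
  | rel r v w, p, q => .ite r v w p q
  | not f, p, q => f.ite q p
  | and f g, p, q => f.ite (g.ite p q) q
  | or f g, p, q => f.ite p (g.ite p q)

open Classical in
theorem act_ite [DecidableEq V] (M : ℕ) (f : Form V R) (p q : Cmd V R) (s : Abs V R) :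
    (f.ite p q).act M s = if f.Holds M s.r s.c then p.act M s else q.act M s := by
  induction f generalizing p q with
  | rel r v w => rfl
  | not f ih =>
    simp only [ite, ih, Holds]
    by_cases h : f.Holds M s.r s.c <;> simp [h]
  | and f g ihf ihg =>
    simp only [ite, ihf, ihg, Holds]
    by_cases h : f.Holds M s.r s.c <;> simp [h]
  | or f g ihf ihg =>
    simp only [ite, ihf, ihg, Holds]
    by_cases h : f.Holds M s.r s.c <;> simp [h]

end Form

/-! ### Applying a rule: passes and saturation. -/

section pass

variable (M : ℕ) (f : Form V R) (r : R) (x y : V)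

open Classical in
/-- Apply the rule "if `f` then `r x y`" under an assignment. -/
noncomputable def ruleStep (ρ : R → ℕ → ℕ → Prop) (τ : V → ℕ) : R → ℕ → ℕ → Prop :=
  if f.Holds M ρ τ then insertRel M ρ r (τ x) (τ y) else ρ

/-- Apply a rule under all assignments in a list. -/
noncomputable def rulePass (L : List (V → ℕ)) (ρ : R → ℕ → ℕ → Prop) : R → ℕ → ℕ → Prop :=
  L.foldl (ruleStep M f r x y) ρ

variable {M f r x y}

theorem le_ruleStep {ρ : R → ℕ → ℕ → Prop} {τ : V → ℕ} : ρ ≤ ruleStep M f r x y ρ τ := by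
  intro r' i j h
  unfold ruleStep
  split_ifs
  · exact .inl h
  · exact h

theorem le_rulePass (L : List (V → ℕ)) (ρ : R → ℕ → ℕ → Prop) : ρ ≤ rulePass M f r x y L ρ := by
  induction L generalizing ρ with
  | nil => exact le_rfl
  | cons τ L ih => exact le_ruleStep.trans (ih _)

/-- Within a pass, later assignments see the pairs inserted by earlier ones; invariants are
therefore checked insertion by insertion. -/
theorem rulePass_induction (L : List (V → ℕ)) {Q : (R → ℕ → ℕ → Prop) → Prop}
    (hQ : ∀ τ ∈ L, ∀ ρ, Q ρ → f.Holds M ρ τ → Q (insertRel M ρ r (τ x) (τ y)))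
    {ρ : R → ℕ → ℕ → Prop} (hρ : Q ρ) : Q (rulePass M f r x y L ρ) := by
  induction L generalizing ρ with
  | nil => exact hρ
  | cons τ L ih =>
    refine ih (fun τ' hτ' => hQ τ' (List.mem_cons_of_mem _ hτ')) ?_
    unfold ruleStep
    split_ifs with h
    · exact hQ τ List.mem_cons_self ρ hρ h
    · exact hρ

theorem rulePass_of_ne (L : List (V → ℕ)) (ρ : R → ℕ → ℕ → Prop) {r' : R} (h : r' ≠ r) :
    rulePass M f r x y L ρ r' = ρ r' := by
  refine rulePass_induction L (Q := fun ρ' => ρ' r' = ρ r') (fun τ _ ρ' h1 _ => ?_) rfl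
  rw [← h1]
  funext i j
  simp [insertRel, h]

theorem of_rulePass (L : List (V → ℕ)) {ρ : R → ℕ → ℕ → Prop} {r' : R} {i j : ℕ}
    (h : rulePass M f r x y L ρ r' i j) : ρ r' i j ∨ (r' = r ∧ i < M ∧ j < M) := by
  refine rulePass_induction L (Q := fun ρ' => ρ' r' i j → ρ r' i j ∨ (r' = r ∧ i < M ∧ j < M))
    (fun τ _ ρ' h1 _ h2 => ?_) .inl h
  rcases h2 with h2 | ⟨rfl, rfl, rfl, h2⟩
  · exact h1 h2
  · exact .inr ⟨rfl, h2⟩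

/-- As `r` does not occur in `f`, insertions made during the pass do not influence later tests, and
all tests may refer to the initial `ρ`. -/
theorem rulePass_self (hf : f.Free r) (L : List (V → ℕ)) (ρ : R → ℕ → ℕ → Prop) (i j : ℕ) :
    rulePass M f r x y L ρ r i j ↔
      ρ r i j ∨ ∃ τ ∈ L, f.Holds M ρ τ ∧ i = τ x ∧ j = τ y ∧ i < M ∧ j < M := by
  induction L generalizing ρ with
  | nil => simp [rulePass]
  | cons τ L ih =>
    change rulePass M f r x y L (ruleStep M f r x y ρ τ) r i j ↔ _
    have h1 (τ') : f.Holds M (ruleStep M f r x y ρ τ) τ' ↔ f.Holds M ρ τ' :=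
      hf.holds_congr (fun r' hr' => rulePass_of_ne [τ] ρ hr') τ'
    have h2 : ruleStep M f r x y ρ τ r i j ↔
        ρ r i j ∨ (f.Holds M ρ τ ∧ i = τ x ∧ j = τ y ∧ i < M ∧ j < M) := by
      unfold ruleStep
      split_ifs with h
      · simp only [insertRel, h]
        constructor
        · rintro (h3 | ⟨-, rfl, rfl, h3⟩)
          · exact .inl h3
          · exact .inr ⟨trivial, rfl, rfl, h3⟩
        · rintro (h3 | ⟨-, rfl, rfl, h3⟩)
          · exact .inl h3
          · exact .inr ⟨trivial, rfl, rfl, h3⟩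
      · simp [h]
    rw [ih, h2]
    simp only [h1, List.mem_cons, exists_eq_or_imp, or_assoc]

/-- Steps only add pairs, so if the whole pass adds nothing, neither does any single step. -/
theorem rulePass_closed {L : List (V → ℕ)} {ρ : R → ℕ → ℕ → Prop}
    (h : rulePass M f r x y L ρ = ρ) {τ : V → ℕ} (hτ : τ ∈ L) (hf : f.Holds M ρ τ)
    (hx : τ x < M) (hy : τ y < M) : ρ r (τ x) (τ y) := by
  induction L with
  | nil => simp at hτ
  | cons τ' L ih =>
    have h1 : ruleStep M f r x y ρ τ' = ρ :=
      le_antisymm ((le_rulePass L _).trans h.le) le_ruleStep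
    have h2 : rulePass M f r x y L ρ = ρ := by
      conv_lhs => rw [← h1]
      exact h
    rcases List.mem_cons.1 hτ with rfl | hτ
    · rw [← h1, ruleStep, if_pos hf]
      exact .inr ⟨rfl, rfl, rfl, hx, hy⟩
    · exact ih h2 hτ

/-- Each pass that is not stationary adds one of the `M * M` pairs of indices to `r`, and a
stationary pass stays stationary. -/
theorem rulePass_iterate_fixed (L : List (V → ℕ)) (ρ : R → ℕ → ℕ → Prop) :
    rulePass M f r x y L ((rulePass M f r x y L)^[M * M] ρ) = (rulePass M f r x y L)^[M * M] ρ := by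
  classical
  set F := rulePass M f r x y L with hF
  let W := Finset.range M ×ˢ Finset.range M
  let g (ρ : R → ℕ → ℕ → Prop) : ℕ := (W.filter fun p => ρ r p.1 p.2).card
  have hg (ρ) : g ρ ≤ M * M := by
    refine (Finset.card_filter_le _ _).trans ?_
    simp [W]
  have hlt (ρ) : F ρ = ρ ∨ g ρ < g (F ρ) := by
    by_contra! hcon
    refine hcon.1 (le_antisymm ?_ (le_rulePass L ρ))
    intro r' i j hij
    rcases of_rulePass L hij with h | ⟨rfl, hi, hj⟩
    · exact h
    · have hsub : (W.filter fun p => ρ r' p.1 p.2) ⊆ W.filter fun p => F ρ r' p.1 p.2 :=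
        Finset.monotone_filter_right _ fun p _ hp => le_rulePass L ρ r' p.1 p.2 hp
      have heq := Finset.eq_of_subset_of_card_le hsub hcon.2
      have : (i, j) ∈ W.filter fun p => F ρ r' p.1 p.2 := by simp [W, hi, hj, hij]
      rw [← heq] at this
      exact (Finset.mem_filter.1 this).2
  have key (k : ℕ) : F (F^[k] ρ) = F^[k] ρ ∨ k ≤ g (F^[k] ρ) := by
    induction k with
    | zero => exact .inr (Nat.zero_le _)
    | succ k ih =>
      rw [iterate_succ_apply']
      rcases ih with h | h
      · left; rw [h, h]
      · rcases hlt (F^[k] ρ) with h1 | h1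
        · left; rw [h1, h1]
        · right; omega
  rcases key (M * M) with h | h
  · exact h
  · rcases hlt (F^[M * M] ρ) with h1 | h1
    · exact h1
    · have := hg (F (F^[M * M] ρ))
      omega

theorem rulePass_iterate_of_ne (L : List (V → ℕ)) (k : ℕ) (ρ : R → ℕ → ℕ → Prop) {r' : R}
    (h : r' ≠ r) : (rulePass M f r x y L)^[k] ρ r' = ρ r' := by
  induction k with
  | zero => rfl
  | succ k ih => rw [iterate_succ_apply', rulePass_of_ne _ _ h, ih]

theorem le_rulePass_iterate (L : List (V → ℕ)) (k : ℕ) (ρ : R → ℕ → ℕ → Prop) :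
    ρ ≤ (rulePass M f r x y L)^[k] ρ := by
  induction k with
  | zero => exact le_rfl
  | succ k ih =>
    rw [iterate_succ_apply']
    exact ih.trans (le_rulePass _ _)

end pass

/-! ### Loops over all assignments of variables. -/

section forAll

variable [DecidableEq V]

/-- All assignments that have values less than `M` at the variables in a list and
agree with a given one at the others. -/
def assigns (M : ℕ) : List V → (V → ℕ) → List (V → ℕ)
  | [], c => [c]
  | v :: vs, c => (List.range M).flatMap fun k => assigns M vs (update c v k)

/-- The values at `vs` are overwritten, so whatever an earlier pass left in these counters is
irrelevant. -/
theorem assigns_congr (M : ℕ) (vs : List V) {c c' : V → ℕ} (h : ∀ w ∉ vs, c w = c' w) :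
    assigns M vs c = assigns M vs c' := by
  induction vs generalizing c c' with
  | nil => simp [assigns, show c = c' from funext fun w => h w (by simp)]
  | cons v vs ih =>
    unfold assigns
    congr 1
    funext k
    refine ih fun w hw => ?_
    by_cases hv : w = v
    · subst hv; simp
    · simp [hv, h w (by simp [hv, hw])]

theorem mem_assigns {M : ℕ} {vs : List V} (hvs : vs.Nodup) {c τ : V → ℕ} :
    τ ∈ assigns M vs c ↔ (∀ v ∈ vs, τ v < M) ∧ ∀ w ∉ vs, τ w = c w := by
  induction vs generalizing c with
  | nil => simp [assigns, funext_iff]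
  | cons v vs ih =>
    rw [List.nodup_cons] at hvs
    simp only [assigns, List.mem_flatMap, List.mem_range, ih hvs.2]
    constructor
    · rintro ⟨k, hk, h1, h2⟩
      refine ⟨?_, fun w hw => ?_⟩
      · rintro w hw
        rcases List.mem_cons.1 hw with rfl | hw
        · rw [h2 _ hvs.1]; simpa using hk
        · exact h1 w hw
      · simp only [List.mem_cons, not_or] at hw
        rw [h2 w hw.2, update_of_ne hw.1]
    · rintro ⟨h1, h2⟩
      refine ⟨τ v, h1 v (by simp), fun w hw => h1 w (by simp [hw]), fun w hw => ?_⟩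
      by_cases hv : w = v
      · subst hv; simp
      · rw [update_of_ne hv, h2 w (by simp [hv, hw])]

/-- Execute a command for all values of some counters. -/
def forAll : List V → Cmd V R → Cmd V R
  | [], p => p
  | v :: vs, p => .seq (.zero v) (.loop (.seq (forAll vs p) (.inc v)))

theorem act_forAll {M : ℕ} {p : Cmd V R}
    {g : (R → ℕ → ℕ → Prop) → (V → ℕ) → R → ℕ → ℕ → Prop}
    (hp : ∀ s, p.act M s = { s with r := g s.r s.c }) {vs : List V} (hvs : vs.Nodup)
    (s : Abs V R) :
    ((forAll vs p).act M s).inp = s.inp ∧ (∀ w ∉ vs, ((forAll vs p).act M s).c w = s.c w) ∧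
      ((forAll vs p).act M s).r = (assigns M vs s.c).foldl g s.r := by
  induction vs generalizing s with
  | nil => simp [forAll, hp, assigns]
  | cons v vs ih =>
    rw [List.nodup_cons] at hvs
    simp only [forAll, Cmd.act]
    set F : Abs V R → Abs V R := fun s =>
      { (forAll vs p).act M s with
        c := update ((forAll vs p).act M s).c v (((forAll vs p).act M s).c v + 1) } with hF
    set s0 : Abs V R := { s with c := update s.c v 0 } with hs0
    -- After `m` rounds the counter `v`, which the inner loops do not touch, holds `m`, and its
    -- values below `m` have been processed.
    have key (m : ℕ) : (F^[m] s0).inp = s.inp ∧ (F^[m] s0).c v = m ∧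
        (∀ w ∉ v :: vs, (F^[m] s0).c w = s.c w) ∧
        (F^[m] s0).r =
          ((List.range m).flatMap fun k => assigns M vs (update s.c v k)).foldl g s.r := by
      induction m with
      | zero => simp +contextual [hs0]
      | succ m ihm =>
        obtain ⟨h1, h2, h3, h4⟩ := ihm
        obtain ⟨i1, i2, i3⟩ := ih hvs.2 (F^[m] s0)
        rw [iterate_succ_apply']
        refine ⟨i1.trans h1, ?_, fun w hw => ?_, ?_⟩
        · exact (update_self ..).trans (by rw [i2 v hvs.1, h2])
        · have hw' := hw
          simp only [List.mem_cons, not_or] at hw'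
          simp only [hF, update_of_ne hw'.1]
          rw [i2 w hw'.2, h3 w hw]
        · rw [List.range_succ, List.flatMap_append, List.foldl_append, ← h4]
          simp only [List.flatMap_cons, List.flatMap_nil, List.append_nil]
          rw [assigns_congr M vs (c := update s.c v m) (c' := (F^[m] s0).c)]
          · exact i3
          · intro w hw
            by_cases hv : w = v
            · subst hv; simp [h2]
            · rw [update_of_ne hv, h3 w (by simp [hv, hw])]
    obtain ⟨h1, h2, h3, h4⟩ := key M
    exact ⟨h1, h3, h4⟩

/-- The command that applies the rule "if `f` then `r x y`" for all values of some counters. -/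
def rule (vs : List V) (f : Form V R) (r : R) (x y : V) : Cmd V R :=
  forAll vs (f.ite (.set r x y) .skip)

theorem act_rule (M : ℕ) {vs : List V} (hvs : vs.Nodup) (f : Form V R) (r : R) (x y : V)
    (s : Abs V R) :
    ((rule vs f r x y).act M s).inp = s.inp ∧
      (∀ w ∉ vs, ((rule vs f r x y).act M s).c w = s.c w) ∧
      ((rule vs f r x y).act M s).r = rulePass M f r x y (assigns M vs s.c) s.r := by
  refine act_forAll (fun s => ?_) hvs s
  rw [Form.act_ite]
  unfold ruleStep
  split_ifs <;> rfl

theorem act_loop_loop_rule (M : ℕ) {vs : List V} (hvs : vs.Nodup) (f : Form V R) (r : R) (x y : V)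
    (s : Abs V R) :
    ((Cmd.loop (.loop (rule vs f r x y))).act M s).inp = s.inp ∧
      (∀ w ∉ vs, ((Cmd.loop (.loop (rule vs f r x y))).act M s).c w = s.c w) ∧
      ((Cmd.loop (.loop (rule vs f r x y))).act M s).r =
        (rulePass M f r x y (assigns M vs s.c))^[M * M] s.r := by
  have h0 : (Cmd.loop (.loop (rule vs f r x y))).act M s =
      ((rule vs f r x y).act M)^[M * M] s := by
    rw [iterate_mul]
    rfl
  rw [h0]
  generalize M * M = k
  induction k with
  | zero => simp
  | succ k ih =>
    obtain ⟨h1, h2, h3⟩ := ih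
    obtain ⟨i1, i2, i3⟩ := act_rule M hvs f r x y (((rule vs f r x y).act M)^[k] s)
    simp only [iterate_succ_apply']
    refine ⟨i1.trans h1, fun w hw => (i2 w hw).trans (h2 w hw), ?_⟩
    rw [i3, h3, assigns_congr M vs h2]

end forAll

/-! ### Parsing the input into tables. -/

/-- The counters of the machine that decides multicolored graph realization. -/
inductive Var where
  | u
  | v
  | a
  | b
  | z
  deriving DecidableEq

instance : Fintype Var := ⟨{.u, .v, .a, .b, .z}, fun x => by cases x <;> simp⟩

/-- The tables of the machine that decides multicolored graph realization. -/
inductive Rel where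
  | eq
  | vert
  | adj
  | bit (b : Bool)
  | diff
  | mate
  | part
  | conf
  | bad
  deriving DecidableEq, Fintype

/-- The command for a letter of the input. The counter `u` is the number of the vertex, `v` is the
number of the bit in the color or in the row of the adjacency matrix, and `a` tells these apart. -/
def parseStep : Option Γ' → Cmd Var Rel
  | some (.bit b) => .ite .eq .a .z (.seq (.set (.bit b) .u .v) (.inc .v))
      (.seq (if b then .set .adj .u .v else .skip) (.inc .v))
  | some .comma => .seq (.inc .a) (.zero .v)
  | some .ket => .seq (.set .vert .u .u) (.seq (.inc .u) (.seq (.zero .a) (.zero .v)))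
  | _ => .skip

section parse

variable {M : ℕ}

/-- The relation to which a bit is added. -/
def target (color b : Bool) : Option Rel :=
  if color then some (.bit b) else if b then some .adj else none

theorem act_read_bit {c : Var → ℕ} {ρ : Rel → ℕ → ℕ → Prop} {l : List Γ'} (m b : Bool)
    (hm : testRel M ρ .eq (c .a) (c .z) ↔ m = true) :
    ∃ ρ', (Cmd.read parseStep).act M ⟨c, ρ, .bit b :: l⟩ = ⟨update c .v (c .v + 1), ρ', l⟩ ∧
      ∀ r i j, ρ' r i j ↔
        ρ r i j ∨ (target m b = some r ∧ i = c .u ∧ j = c .v ∧ i < M ∧ j < M) := by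
  cases m with
  | true =>
    refine ⟨insertRel M ρ (.bit b) (c .u) (c .v), ?_, fun r i j => ?_⟩
    · simp [Cmd.act, parseStep, hm]
    · simp only [insertRel, target, if_true, Option.some.injEq]
      constructor <;> rintro (h | ⟨rfl, rfl, rfl, h⟩) <;> simp [*]
  | false =>
    cases b with
    | true =>
      refine ⟨insertRel M ρ .adj (c .u) (c .v), ?_, fun r i j => ?_⟩
      · simp [Cmd.act, parseStep, hm]
      · simp only [insertRel, target, if_true, Option.some.injEq, Bool.false_eq_true, if_false]
        constructor <;> rintro (h | ⟨rfl, rfl, rfl, h⟩) <;> simp [*]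
    | false =>
      refine ⟨ρ, ?_, fun r i j => ?_⟩
      · simp [Cmd.act, parseStep, hm]
      · simp [target]

/-- Reading bits leaves `eq` alone, so the test that separates color bits from adjacency bits keeps
its meaning. -/
theorem target_ne_eq (m b : Bool) : target m b ≠ some .eq := by
  cases m <;> cases b <;> simp [target]

/-- The surplus `k` of iterations allows the pieces of the input to be chained under a single
iteration count. -/
theorem iterate_read_bits (bs : List Bool) (m : Bool) : ∀ (k : ℕ) (c : Var → ℕ)
    (ρ : Rel → ℕ → ℕ → Prop) (l : List Γ'), (testRel M ρ .eq (c .a) (c .z) ↔ m = true) →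
    ∃ ρ', ((Cmd.read parseStep).act M)^[bs.length + k] ⟨c, ρ, bs.map .bit ++ l⟩ =
        ((Cmd.read parseStep).act M)^[k] ⟨update c .v (c .v + bs.length), ρ', l⟩ ∧
      ∀ r i j, ρ' r i j ↔ ρ r i j ∨ ∃ t b, bs[t]? = some b ∧ target m b = some r ∧
        i = c .u ∧ j = c .v + t ∧ i < M ∧ j < M := by
  induction bs with
  | nil =>
    intro k c ρ l _
    exact ⟨ρ, by simp, by simp⟩
  | cons b bs ih =>
    intro k c ρ l hm
    obtain ⟨ρ1, h1, h1'⟩ := act_read_bit (l := bs.map .bit ++ l) m b hm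
    have hm1 : testRel M ρ1 .eq (update c .v (c .v + 1) .a) (update c .v (c .v + 1) .z) ↔
        m = true := by
      rw [← hm]
      simp [testRel, h1', target_ne_eq]
    obtain ⟨ρ2, h2, h2'⟩ := ih k _ ρ1 l hm1
    refine ⟨ρ2, ?_, fun r i j => ?_⟩
    · rw [List.length_cons, Nat.add_right_comm, iterate_succ_apply, List.map_cons, List.cons_append,
        h1, h2]
      simp [add_assoc, add_comm 1]
    · rw [h2', h1', or_assoc]
      refine or_congr_right ⟨?_, ?_⟩
      · rintro (⟨h3, rfl, rfl, h4⟩ | ⟨t, b', h3, h4, rfl, rfl, h5⟩)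
        · exact ⟨0, b, rfl, h3, rfl, rfl, h4⟩
        · exact ⟨t + 1, b', h3, h4, rfl, by simp [add_assoc, add_comm 1], h5⟩
      · rintro ⟨t, b', h3, h4, rfl, rfl, h5⟩
        cases t with
        | zero =>
          obtain rfl : b = b' := by simpa using h3
          exact .inl ⟨h4, rfl, rfl, h5⟩
        | succ t => exact .inr ⟨t, b', h3, h4, rfl, by simp [add_assoc, add_comm 1], h5⟩

/-- The word for a vertex, given its color and its row of the adjacency matrix. -/
def vertexWord (d : List Bool × List Bool) : List Γ' :=
  d.1.map .bit ++ .comma :: d.2.map .bit ++ [.ket]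

/-- The pairs with first entry `i` that are added to a relation when the word of the vertex `i` is
read. -/
def VertexEntry (d : List Bool × List Bool) (i : ℕ) (r : Rel) (j : ℕ) : Prop :=
  (∃ b, d.1[j]? = some b ∧ r = .bit b) ∨ (d.2[j]? = some true ∧ r = .adj) ∨ (r = .vert ∧ j = i)

/-- The value `a = 0` marks the color phase. The comma raises it to `1`, which `eq` distinguishes
from `z = 0`, and the end marker resets `a` and `v` for the next vertex. The bound `0 < M` puts `(0,
0)` into `eq`. -/
theorem iterate_read_vertexWord (hM : 0 < M) (d : List Bool × List Bool) (k : ℕ) (c : Var → ℕ)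
    (ρ : Rel → ℕ → ℕ → Prop) (l : List Γ') (hv : c .v = 0) (ha : c .a = 0) (hz : c .z = 0)
    (hρ : ∀ i j, ρ .eq i j ↔ i = j ∧ i < M) :
    ∃ ρ', ((Cmd.read parseStep).act M)^[(vertexWord d).length + k] ⟨c, ρ, vertexWord d ++ l⟩ =
        ((Cmd.read parseStep).act M)^[k] ⟨update c .u (c .u + 1), ρ', l⟩ ∧
      ∀ r i j, ρ' r i j ↔
        ρ r i j ∨ (i = c .u ∧ i < M ∧ j < M ∧ VertexEntry d i r j) := by
  obtain ⟨cs, bs⟩ := d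
  obtain ⟨ρ1, h1, h1'⟩ := iterate_read_bits (M := M) cs true (bs.length + (k + 1) + 1) c ρ
    (.comma :: bs.map .bit ++ .ket :: l) (by simp [testRel, hρ, ha, hz, hM])
  have e1 (l : List Γ') : (Cmd.read parseStep).act M ⟨update c .v (c .v + cs.length), ρ1,
      .comma :: l⟩ = ⟨update c .a 1, ρ1, l⟩ := by
    simp only [Cmd.act, parseStep, List.head?_cons, List.tail_cons, Abs.mk.injEq, and_true]
    funext x
    cases x <;> simp [hv, ha]
  obtain ⟨ρ2, h2, h2'⟩ := iterate_read_bits (M := M) bs false (k + 1) (update c .a 1) ρ1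
    (.ket :: l) (by simp [testRel, h1', target_ne_eq, hρ, hz])
  have e2 : (Cmd.read parseStep).act M ⟨update (update c .a 1) .v (update c .a 1 .v + bs.length), ρ2,
      .ket :: l⟩ = ⟨update c .u (c .u + 1), insertRel M ρ2 .vert (c .u) (c .u), l⟩ := by
    simp only [Cmd.act, parseStep, List.head?_cons, List.tail_cons, Abs.mk.injEq, and_true]
    refine ⟨?_, by simp⟩
    funext x
    cases x <;> simp [hv, ha]
  refine ⟨insertRel M ρ2 .vert (c .u) (c .u), ?_, fun r i j => ?_⟩
  · have e3 : (vertexWord (cs, bs)).length + k = cs.length + (bs.length + (k + 1) + 1) := by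
      simp [vertexWord]
      ring
    have e4 : vertexWord (cs, bs) ++ l = cs.map .bit ++ (.comma :: bs.map .bit ++ .ket :: l) := by
      simp [vertexWord]
    rw [e3, e4, h1, iterate_succ_apply, List.cons_append, e1, h2, iterate_succ_apply, e2]
  · simp only [insertRel, h2', h1', VertexEntry, or_assoc]
    refine or_congr_right ⟨?_, ?_⟩
    · rintro (⟨t, b, h3, h4, rfl, rfl, h5, h6⟩ | ⟨t, b, h3, h4, rfl, rfl, h5, h6⟩ |
        ⟨rfl, rfl, rfl, h5, h6⟩)
      · simp only [hv, zero_add] at h6 ⊢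
        exact ⟨trivial, h5, h6, .inl ⟨b, h3, by simpa [target, eq_comm] using h4⟩⟩
      · simp only [update_of_ne (show Var.v ≠ Var.a by simp), update_of_ne (show Var.u ≠ Var.a by simp),
          hv, zero_add] at h5 h6 ⊢
        cases b with
        | false => simp [target] at h4
        | true => exact ⟨trivial, h5, h6, .inr (.inl ⟨h3, by simpa [target, eq_comm] using h4⟩)⟩
      · exact ⟨rfl, h5, h6, .inr (.inr ⟨rfl, rfl⟩)⟩
    · rintro ⟨rfl, h5, h6, ⟨b, h3, rfl⟩ | ⟨h3, rfl⟩ | ⟨rfl, rfl⟩⟩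
      · exact .inl ⟨j, b, h3, rfl, rfl, by simp [hv], h5, h6⟩
      · exact .inr (.inl ⟨j, true, h3, rfl, by simp, by simp [hv], h5, h6⟩)
      · exact .inr (.inr ⟨rfl, rfl, rfl, h5, h6⟩)

theorem iterate_read_vertexWords (hM : 0 < M) (D : List (List Bool × List Bool)) :
    ∀ (k : ℕ) (c : Var → ℕ) (ρ : Rel → ℕ → ℕ → Prop) (l : List Γ'), c .v = 0 → c .a = 0 →
    c .z = 0 → (∀ i j, ρ .eq i j ↔ i = j ∧ i < M) →
    ∃ ρ', ((Cmd.read parseStep).act M)^[(D.map vertexWord).flatten.length + k]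
          ⟨c, ρ, (D.map vertexWord).flatten ++ l⟩ =
        ((Cmd.read parseStep).act M)^[k] ⟨update c .u (c .u + D.length), ρ', l⟩ ∧
      ∀ r i j, ρ' r i j ↔ ρ r i j ∨ ∃ t d, D[t]? = some d ∧
        i = c .u + t ∧ i < M ∧ j < M ∧ VertexEntry d i r j := by
  induction D with
  | nil =>
    intro k c ρ l _ _ _ _
    exact ⟨ρ, by simp, by simp⟩
  | cons d D ih =>
    intro k c ρ l hv ha hz hρ
    obtain ⟨ρ1, h1, h1'⟩ := iterate_read_vertexWord hM d ((D.map vertexWord).flatten.length + k) c ρ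
      ((D.map vertexWord).flatten ++ l) hv ha hz hρ
    obtain ⟨ρ2, h2, h2'⟩ := ih k (update c .u (c .u + 1)) ρ1 l (by simpa using hv) (by simpa using ha)
      (by simpa using hz) fun i j => by simp [h1', hρ, VertexEntry]
    refine ⟨ρ2, ?_, fun r i j => ?_⟩
    · rw [List.map_cons, List.flatten_cons, List.length_append, add_assoc, List.append_assoc, h1, h2]
      simp [add_assoc, add_comm 1]
    · rw [h2', h1', or_assoc]
      refine or_congr_right ⟨?_, ?_⟩
      · rintro (⟨rfl, h3⟩ | ⟨t, d', h3, rfl, h4⟩)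
        · exact ⟨0, d, rfl, rfl, h3⟩
        · exact ⟨t + 1, d', h3, by simp [add_assoc, add_comm 1], h4⟩
      · rintro ⟨t, d', h3, rfl, h4⟩
        cases t with
        | zero =>
          obtain rfl : d = d' := by simpa using h3
          exact .inl ⟨rfl, h4⟩
        | succ t => exact .inr ⟨t, d', h3, by simp [add_assoc, add_comm 1], h4⟩

end parse

end StackMachine

/-! ### The combinatorial core: resolution for 2-SAT. -/

namespace ColoredGraph

variable (I : ColoredGraph)

/-- `a` and `b` are all the vertices of a color class. -/
def Partner (a b : Fin I.n) : Prop :=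
  I.φ a = I.φ b ∧ (a ≠ b ∨ ∀ c, I.φ c = I.φ a → c = a)

/-- `u` and `v` obviously cannot both belong to a multicolored realization. -/
def BaseConflict (u v : Fin I.n) : Prop :=
  (I.φ u = I.φ v ∧ u ≠ v) ∨
    (I.φ u ≠ I.φ v ∧ ¬ I.G.Adj u v ∧ ∃ a b, I.G.Adj a b ∧ I.φ a = I.φ u ∧ I.φ b = I.φ v)

/-- `u` and `v` cannot both belong to a multicolored realization, as derived by resolution. -/
inductive Conflict : Fin I.n → Fin I.n → Prop
  | base {u v : Fin I.n} (h : I.BaseConflict u v) : Conflict u v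
  | resolve {u v a b : Fin I.n} (h : I.Partner a b) (hu : Conflict u a) (hv : Conflict v b) :
    Conflict u v

variable {I}

theorem Partner.symm {a b : Fin I.n} (h : I.Partner a b) : I.Partner b a := by
  refine ⟨h.1.symm, ?_⟩
  rcases h.2 with h2 | h2
  · exact .inl h2.symm
  · exact .inr fun c hc => (h2 c (hc.trans h.1.symm)).trans (h2 b h.1.symm).symm

theorem exists_partner (a : Fin I.n) : ∃ b, I.Partner a b := by
  by_cases h : ∀ c, I.φ c = I.φ a → c = a
  · exact ⟨a, rfl, .inr h⟩
  · push Not at h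
    obtain ⟨c, hc, hne⟩ := h
    exact ⟨c, hc.symm, .inl hne.symm⟩

/-- This is where the bound on the cluster size enters: a third vertex would give a class of size
three. -/
theorem Partner.eq_or_eq (hI : I.clusterSize ≤ 2) {a b c : Fin I.n} (h : I.Partner a b)
    (hc : I.φ c = I.φ a) : c = a ∨ c = b := by
  rcases h.2 with hab | h2
  · by_contra! hne
    have h1 : ({a, b, c} : Finset (Fin I.n)) ⊆ Finset.univ.filter fun w => I.φ w = I.φ a := by
      intro w hw
      simp only [Finset.mem_insert, Finset.mem_singleton] at hw
      rcases hw with rfl | rfl | rfl <;> simp [hc, h.1]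
    have h2 := Finset.card_le_card h1
    rw [Finset.card_eq_three.2 ⟨a, b, c, hab, hne.1.symm, hne.2.symm, rfl⟩] at h2
    have h3 := Finset.le_sup (f := fun v : Fin I.n =>
      (Finset.univ.filter fun w : Fin I.n => I.φ w = I.φ v).card) (Finset.mem_univ a)
    have h4 := h3.trans hI
    omega
  · exact .inl (h2 c hc)

theorem BaseConflict.symm {u v : Fin I.n} (h : I.BaseConflict u v) : I.BaseConflict v u := by
  rcases h with ⟨h1, h2⟩ | ⟨h1, h2, a, b, hab, ha, hb⟩
  · exact .inl ⟨h1.symm, h2.symm⟩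
  · exact .inr ⟨h1.symm, fun h => h2 h.symm, b, a, hab.symm, hb, ha⟩

theorem Conflict.symm {u v : Fin I.n} (h : I.Conflict u v) : I.Conflict v u := by
  induction h with
  | base h => exact .base h.symm
  | resolve h hu hv _ _ => exact .resolve h.symm hv hu

/-- The two kinds of base conflict are failures of injectivity of `φ` on `S` and non-edges of `G[S]`
above edges of the cluster graph. Conversely, an edge between vertices of different colors always
gives an edge of the cluster graph, so nothing else can go wrong. -/
theorem hasMulticoloredRealization_iff_baseConflict :
    I.HasMulticoloredRealization ↔ ∃ S : Set (Fin I.n), (∀ a, ∃ w ∈ S, I.φ w = I.φ a) ∧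
      ∀ u ∈ S, ∀ v ∈ S, ¬ I.BaseConflict u v := by
  constructor
  · rintro ⟨S, hS, e, he⟩
    refine ⟨S, fun a => ?_, fun u hu v hv huv => ?_⟩
    · obtain ⟨w, hw⟩ := Set.ncard_eq_one.1 (hS _ ⟨a, rfl⟩)
      have : w ∈ S ∩ I.φ ⁻¹' {I.φ a} := hw ▸ rfl
      exact ⟨w, this⟩
    · rcases huv with ⟨h1, h2⟩ | ⟨h1, h2, a, b, hab, ha, hb⟩
      · obtain ⟨w, hw⟩ := Set.ncard_eq_one.1 (hS _ ⟨v, rfl⟩)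
        have e1 : u ∈ ({w} : Set (Fin I.n)) := hw ▸ ⟨hu, h1⟩
        have e2 : v ∈ ({w} : Set (Fin I.n)) := hw ▸ ⟨hv, rfl⟩
        exact h2 (e1.trans e2.symm)
      · refine h2 (e.map_rel_iff (a := ⟨u, hu⟩) (b := ⟨v, hv⟩) |>.1 ⟨fun h => h1 ?_, a, b, hab, ?_, ?_⟩)
        · rw [← he ⟨u, hu⟩, ← he ⟨v, hv⟩, h]
        · rw [he, ha]
        · rw [he, hb]
  · rintro ⟨S, hS, hC⟩
    have hinj : ∀ u ∈ S, ∀ v ∈ S, I.φ u = I.φ v → u = v := fun u hu v hv h => by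
      by_contra hne
      exact hC u hu v hv (.inl ⟨h, hne⟩)
    refine ⟨S, ?_, ?_⟩
    · rintro _ ⟨a, rfl⟩
      obtain ⟨w, hw, hwa⟩ := hS a
      refine Set.ncard_eq_one.2 ⟨w, Set.ext fun x => ⟨fun hx => ?_, ?_⟩⟩
      · exact hinj x hx.1 w hw (hx.2.trans hwa.symm)
      · rintro rfl
        exact ⟨hw, hwa⟩
    · have hbij : Function.Bijective fun u : S => (⟨I.φ u, u, rfl⟩ : Set.range I.φ) := by
        constructor
        · intro u v h
          exact Subtype.ext (hinj u u.2 v v.2 (congrArg Subtype.val h))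
        · rintro ⟨_, a, rfl⟩
          obtain ⟨w, hw, hwa⟩ := hS a
          exact ⟨⟨w, hw⟩, Subtype.ext hwa⟩
      refine ⟨⟨Equiv.ofBijective _ hbij, ?_⟩, fun u => rfl⟩
      intro u v
      constructor
      · rintro ⟨h1, a, b, hab, ha, hb⟩
        by_contra h
        exact hC u u.2 v v.2 (.inr ⟨fun h' => h1 (Subtype.ext h'), h, a, b, hab, ha, hb⟩)
      · intro h
        refine ⟨fun h' => h.ne ?_, u, v, h, rfl, rfl⟩
        exact hbij.1 h'

theorem hasMulticoloredRealization_iff (hI : I.clusterSize ≤ 2) :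
    I.HasMulticoloredRealization ↔
      ¬ ∃ a b, I.Partner a b ∧ I.Conflict a a ∧ I.Conflict b b := by
  rw [hasMulticoloredRealization_iff_baseConflict]
  constructor
  · rintro ⟨S, hS, hC⟩ ⟨a, b, hab, ha, hb⟩
    have hmem {a b} (hab : I.Partner a b) : a ∈ S ∨ b ∈ S := by
      obtain ⟨w, hw, hwa⟩ := hS a
      rcases hab.eq_or_eq hI hwa with rfl | rfl
      · exact .inl hw
      · exact .inr hw
    -- Soundness: a set that meets the class of `a` and `b` contains one of them, so one of the two
    -- premises of a resolution step is violated.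
    have key {u v} (h : I.Conflict u v) : ¬ (u ∈ S ∧ v ∈ S) := by
      induction h with
      | base h => exact fun h' => hC _ h'.1 _ h'.2 h
      | resolve h _ _ ihu ihv =>
        rintro ⟨hu, hv⟩
        rcases hmem h with h | h
        · exact ihu ⟨hu, h⟩
        · exact ihv ⟨hv, h⟩
    rcases hmem hab with h | h
    · exact key ha ⟨h, h⟩
    · exact key hb ⟨h, h⟩
  · intro hbad
    -- Completeness: a maximal conflict-free set cannot miss a class. If it misses both `a` and `b`,
    -- each is blocked by an element of `S` or by itself.
    obtain ⟨S, hS⟩ := Set.Finite.exists_maximal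
      (s := {S : Set (Fin I.n) | ∀ u ∈ S, ∀ v ∈ S, ¬ I.Conflict u v}) (Set.toFinite _)
      ⟨∅, by simp⟩
    have hCF : ∀ u ∈ S, ∀ v ∈ S, ¬ I.Conflict u v := hS.1
    refine ⟨S, fun a => ?_, fun u hu v hv h => hCF u hu v hv (.base h)⟩
    have hext (a : Fin I.n) (ha : a ∉ S) : ∃ u, (u ∈ S ∨ u = a) ∧ I.Conflict u a := by
      by_contra! hcon
      refine ha (hS.2 (y := insert a S) ?_ (Set.subset_insert a S) (Set.mem_insert a S))
      intro u hu v hv h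
      rcases hu with rfl | hu
      · rcases hv with rfl | hv
        · exact hcon _ (.inr rfl) h
        · exact hcon _ (.inl hv) h.symm
      · rcases hv with rfl | hv
        · exact hcon _ (.inl hu) h
        · exact hCF u hu v hv h
    obtain ⟨b, hab⟩ := exists_partner a
    by_contra! hcon
    obtain ⟨u, hu, hua⟩ := hext a fun h => hcon a h rfl
    obtain ⟨v, hv, hvb⟩ := hext b fun h => hcon b h hab.1.symm
    -- If at least one blocker lies in `S`, one or two resolution steps produce a conflict inside
    -- `S`. If `a` and `b` both block themselves, the class is excluded by `hbad`.
    rcases hu with hu | rfl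
    · rcases hv with hv | rfl
      · exact hCF u hu v hv (.resolve hab hua hvb)
      · exact hCF u hu u hu (.resolve hab hua (.resolve hab hua hvb))
    · rcases hv with hv | rfl
      · exact hCF v hv v hv (.resolve hab (Conflict.symm (.resolve hab hua hvb)) hvb)
      · exact hbad ⟨_, _, hab, hua, hvb⟩

end ColoredGraph

/-! ### The rules and the relations they compute. -/

namespace StackMachine

open Computability Function

section rules

variable {I : ColoredGraph} {M : ℕ} {ρ : Rel → ℕ → ℕ → Prop}

/-- The variables of the rules. -/
abbrev ruleVars : List Var := [.u, .v, .a, .b]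

/-- The assignments under which the rules are applied. -/
abbrev ruleAssigns (M : ℕ) : List (Var → ℕ) := assigns M ruleVars fun _ => 0

/-- An assignment given by its values. -/
def asg (i j k l : ℕ) : Var → ℕ
  | .u => i
  | .v => j
  | .a => k
  | .b => l
  | .z => 0

theorem asg_mem {i j k l : ℕ} (hi : i < M) (hj : j < M) (hk : k < M) (hl : l < M) :
    asg i j k l ∈ ruleAssigns M := by
  refine (mem_assigns (by decide)).2 ⟨by simp [asg, hi, hj, hk, hl], fun w hw => ?_⟩
  cases w <;> simp_all [asg]

theorem eq_asg {τ : Var → ℕ} (h : τ ∈ ruleAssigns M) : ∃ i j k l, i < M ∧ j < M ∧ k < M ∧ l < M ∧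
    τ = asg i j k l := by
  obtain ⟨h1, h2⟩ := (mem_assigns (by decide)).1 h
  refine ⟨τ .u, τ .v, τ .a, τ .b, h1 _ (by simp), h1 _ (by simp), h1 _ (by simp), h1 _ (by simp),
    funext fun w => ?_⟩
  cases w <;> first | rfl | exact h2 _ (by simp)

/-- Variables that do not occur in the head of a rule become existential quantifiers, since the pass
ranges over all their values. -/
theorem rulePass_u_v {f : Form Var Rel} {r : Rel} (hf : f.Free r) (h0 : ∀ i j, ¬ ρ r i j)
    (i j : ℕ) : rulePass M f r .u .v (ruleAssigns M) ρ r i j ↔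
      i < M ∧ j < M ∧ ∃ k < M, ∃ l < M, f.Holds M ρ (asg i j k l) := by
  rw [rulePass_self hf]
  constructor
  · rintro (h | ⟨τ, hτ, h, rfl, rfl, -⟩)
    · exact (h0 _ _ h).elim
    · obtain ⟨i, j, k, l, hi, hj, hk, hl, rfl⟩ := eq_asg hτ
      exact ⟨hi, hj, k, hk, l, hl, h⟩
  · rintro ⟨hi, hj, k, hk, l, hl, h⟩
    exact .inr ⟨_, asg_mem hi hj hk hl, h, rfl, rfl, hi, hj⟩

theorem rulePass_u_u {f : Form Var Rel} {r : Rel} (hf : f.Free r) (h0 : ∀ i j, ¬ ρ r i j)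
    (i j : ℕ) : rulePass M f r .u .u (ruleAssigns M) ρ r i j ↔
      i = j ∧ i < M ∧ ∃ j' < M, ∃ k < M, ∃ l < M, f.Holds M ρ (asg i j' k l) := by
  rw [rulePass_self hf]
  constructor
  · rintro (h | ⟨τ, hτ, h, rfl, rfl, -⟩)
    · exact (h0 _ _ h).elim
    · obtain ⟨i, j, k, l, hi, hj, hk, hl, rfl⟩ := eq_asg hτ
      exact ⟨rfl, hi, j, hj, k, hk, l, hl, h⟩
  · rintro ⟨rfl, hi, j, hj, k, hk, l, hl, h⟩
    exact .inr ⟨_, asg_mem hi hj hk hl, h, rfl, rfl, hi, hi⟩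

/-- The bits number `a` of the colors of `u` and `v` differ. -/
def diffForm : Form Var Rel :=
  let g (b : Bool) : Form Var Rel :=
    .or (.and (.rel (.bit b) .u .a) (.not (.rel (.bit b) .v .a)))
      (.and (.rel (.bit b) .v .a) (.not (.rel (.bit b) .u .a)))
  .or (g true) (g false)

/-- The vertices `u` and `v` have the same color and are different. -/
def mateForm : Form Var Rel :=
  .and (.and (.rel .vert .u .u) (.rel .vert .v .v))
    (.and (.not (.rel .diff .u .v)) (.not (.rel .eq .u .v)))

/-- The vertices `u` and `v` are all the vertices of a color class. -/
def partForm : Form Var Rel :=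
  .and (.and (.rel .vert .u .u) (.rel .vert .v .v))
    (.and (.not (.rel .diff .u .v)) (.or (.not (.rel .eq .u .v)) (.not (.rel .mate .u .u))))

/-- There is an obvious conflict between the vertices `u` and `v`. -/
def confForm : Form Var Rel :=
  .and (.and (.rel .vert .u .u) (.rel .vert .v .v))
    (.or (.and (.not (.rel .diff .u .v)) (.not (.rel .eq .u .v)))
      (.and (.and (.rel .diff .u .v) (.not (.rel .adj .u .v)))
        (.and (.rel .adj .a .b) (.and (.not (.rel .diff .u .a)) (.not (.rel .diff .v .b))))))

/-- There is a conflict between `u` and `v` by resolution. -/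
def resolveForm : Form Var Rel :=
  .and (.rel .part .a .b) (.and (.rel .conf .u .a) (.rel .conf .v .b))

/-- There is a color class without an admissible vertex. -/
def badForm : Form Var Rel :=
  .and (.rel .part .a .b) (.and (.rel .conf .a .a) (.rel .conf .b .b))

theorem encodeNat_injective : Injective encodeNat := encodingNatBool.encode_injective

/-- A position past the end of a color word is in neither bit relation, so differing lengths are
detected as well; beyond `M` both words have ended. Only vertices are considered, as entries of the
table at other indices carry no meaning. -/
theorem rulePass_diff (hn : I.n < M) (hlen : ∀ i, (encodeNat (I.φ i)).length < M)
    (hbit : ∀ b i j, ρ (.bit b) i j ↔ ∃ h : i < I.n, (encodeNat (I.φ ⟨i, h⟩))[j]? = some b)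
    (h0 : ∀ i j, ¬ ρ .diff i j) (i j : Fin I.n) :
    rulePass M diffForm .diff .u .v (ruleAssigns M) ρ .diff i j ↔ I.φ i ≠ I.φ j := by
  have hi : (i : ℕ) < M := i.2.trans hn
  have hj : (j : ℕ) < M := j.2.trans hn
  rw [rulePass_u_v (by simp [diffForm, Form.Free]) h0]
  simp only [hi, hj, true_and, diffForm, Form.Holds, testRel, asg, hbit, Fin.is_lt, exists_true_left,
    Fin.eta]
  constructor
  · rintro ⟨k, hk, l, -, h⟩ heq
    rw [heq] at h
    tauto
  · intro hne
    by_contra hcon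
    refine hne (encodeNat_injective (List.ext_getElem? fun k => ?_))
    by_cases hk : k < M
    · have h1 := fun h => hcon ⟨k, hk, 0, by omega, h⟩
      simp only [hk, and_true, imp_false, not_or, not_and, not_not] at h1
      obtain ⟨⟨h1, h2⟩, h3, h4⟩ := h1
      cases h5 : (encodeNat (I.φ i))[k]? with
      | none =>
        cases h6 : (encodeNat (I.φ j))[k]? with
        | none => rfl
        | some b => cases b <;> simp_all
      | some b => cases b <;> simp_all
    · rw [List.getElem?_eq_none (by have := hlen i; omega),
        List.getElem?_eq_none (by have := hlen j; omega)]

theorem rulePass_mate (hn : I.n < M) (heq : ∀ i j, ρ .eq i j ↔ i = j ∧ i < M)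
    (hvert : ∀ i j, ρ .vert i j ↔ i = j ∧ i < I.n)
    (hdiff : ∀ i j : Fin I.n, ρ .diff i j ↔ I.φ i ≠ I.φ j) (h0 : ∀ i j, ¬ ρ .mate i j)
    (i : Fin I.n) :
    rulePass M mateForm .mate .u .u (ruleAssigns M) ρ .mate i i ↔
      ∃ j, I.φ j = I.φ i ∧ j ≠ i := by
  have hi : (i : ℕ) < M := i.2.trans hn
  rw [rulePass_u_u (by simp [mateForm, Form.Free]) h0]
  simp only [hi, true_and, mateForm, Form.Holds, testRel, asg, heq, hvert]
  constructor
  · rintro ⟨j, hj, -, -, -, -, ⟨-, hj', -⟩, h1, h2⟩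
    have := hdiff i ⟨j, hj'⟩
    refine ⟨⟨j, hj'⟩, ?_, fun h => h2 ?_⟩
    · by_contra h
      exact h1 ⟨this.2 (Ne.symm h), hj⟩
    · subst h
      simp [hj]
  · rintro ⟨j, hj, hne⟩
    have hjM : (j : ℕ) < M := j.2.trans hn
    refine ⟨j, hjM, 0, by omega, 0, by omega, by simp [hjM], ?_, ?_⟩
    · rw [hdiff]
      simp [hj]
    · intro h
      exact hne (Fin.ext h.1.1.symm)

/-- The `vert` guards are needed because the tables have more than `I.n` rows and `diff` is
meaningful on vertices only. Absence of a `mate` marks a singleton class, whose vertex is its own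
partner. -/
theorem rulePass_part (hn : I.n < M) (heq : ∀ i j, ρ .eq i j ↔ i = j ∧ i < M)
    (hvert : ∀ i j, ρ .vert i j ↔ i = j ∧ i < I.n)
    (hdiff : ∀ i j : Fin I.n, ρ .diff i j ↔ I.φ i ≠ I.φ j)
    (hmate : ∀ i : Fin I.n, ρ .mate i i ↔ ∃ j, I.φ j = I.φ i ∧ j ≠ i)
    (h0 : ∀ i j, ¬ ρ .part i j) (i j : ℕ) :
    rulePass M partForm .part .u .v (ruleAssigns M) ρ .part i j ↔
      ∃ a b : Fin I.n, (a : ℕ) = i ∧ (b : ℕ) = j ∧ I.Partner a b := by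
  rw [rulePass_u_v (by simp [partForm, Form.Free]) h0]
  simp only [partForm, Form.Holds, testRel, asg, heq, hvert]
  constructor
  · rintro ⟨hi, hj, -, -, -, -, ⟨⟨⟨-, hi'⟩, -⟩, ⟨-, hj'⟩, -⟩, h1, h2⟩
    refine ⟨⟨i, hi'⟩, ⟨j, hj'⟩, rfl, rfl, ?_, ?_⟩
    · by_contra h
      exact h1 ⟨(hdiff ⟨i, hi'⟩ ⟨j, hj'⟩).2 h, hi, hj⟩
    · rcases h2 with h2 | h2
      · refine .inl fun h => h2 ?_
        have h3 : i = j := congrArg Fin.val h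
        simp [h3, hj]
      · refine .inr fun c hc => ?_
        by_contra hne
        exact h2 ⟨(hmate ⟨i, hi'⟩).2 ⟨c, hc, hne⟩, hi, hi⟩
  · rintro ⟨a, b, rfl, rfl, h1, h2⟩
    have ha : (a : ℕ) < M := a.2.trans hn
    have hb : (b : ℕ) < M := b.2.trans hn
    refine ⟨ha, hb, 0, by omega, 0, by omega, by simp [ha, hb], ?_, ?_⟩
    · rw [hdiff]
      simp [h1]
    · rcases h2 with h2 | h2
      · exact .inl fun h => h2 (Fin.ext h.1.1)
      · refine .inr fun h => ?_
        obtain ⟨j, hj, hne⟩ := (hmate a).1 h.1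
        exact hne (h2 j hj)

theorem rulePass_conf (hn : I.n < M) (heq : ∀ i j, ρ .eq i j ↔ i = j ∧ i < M)
    (hvert : ∀ i j, ρ .vert i j ↔ i = j ∧ i < I.n)
    (hadj : ∀ i j, ρ .adj i j ↔ ∃ a b : Fin I.n, (a : ℕ) = i ∧ (b : ℕ) = j ∧ I.G.Adj a b)
    (hdiff : ∀ i j : Fin I.n, ρ .diff i j ↔ I.φ i ≠ I.φ j)
    (h0 : ∀ i j, ¬ ρ .conf i j) (i j : ℕ) :
    rulePass M confForm .conf .u .v (ruleAssigns M) ρ .conf i j ↔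
      ∃ a b : Fin I.n, (a : ℕ) = i ∧ (b : ℕ) = j ∧ I.BaseConflict a b := by
  have hM (a : Fin I.n) : (a : ℕ) < M := a.2.trans hn
  have hadj' (a b : Fin I.n) : ρ .adj a b ↔ I.G.Adj a b := by
    rw [hadj]
    constructor
    · rintro ⟨a', b', ha, hb, h⟩
      rwa [← Fin.ext ha, ← Fin.ext hb]
    · exact fun h => ⟨a, b, rfl, rfl, h⟩
  have hholds (u v : Fin I.n) (k l : ℕ) : confForm.Holds M ρ (asg u v k l) ↔
      (I.φ u = I.φ v ∧ u ≠ v) ∨ (I.φ u ≠ I.φ v ∧ ¬ I.G.Adj u v ∧ ∃ a b : Fin I.n,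
        (a : ℕ) = k ∧ (b : ℕ) = l ∧ I.G.Adj a b ∧ I.φ a = I.φ u ∧ I.φ b = I.φ v) := by
    simp only [confForm, Form.Holds, testRel, asg, heq, hvert, hM, hdiff, hadj', Fin.is_lt, and_true,
      true_and, Fin.val_inj, ne_eq, not_not]
    refine or_congr_right ?_
    rw [and_assoc]
    refine and_congr_right fun _ => and_congr_right fun _ => ?_
    constructor
    · rintro ⟨⟨h1, hk, hl⟩, h2, h3⟩
      obtain ⟨a, b, rfl, rfl, hab⟩ := (hadj _ _).1 h1
      simp only [hdiff, hM, and_true, ne_eq, not_not] at h2 h3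
      exact ⟨a, b, rfl, rfl, hab, h2.symm, h3.symm⟩
    · rintro ⟨a, b, rfl, rfl, hab, h2, h3⟩
      simp [hdiff, hM, hadj', hab, h2, h3]
  rw [rulePass_u_v (by simp [confForm, Form.Free]) h0]
  constructor
  · rintro ⟨hi, hj, k, hk, l, hl, h⟩
    have h1 : i < I.n ∧ j < I.n := by
      simp only [confForm, Form.Holds, testRel, asg, hvert] at h
      exact ⟨h.1.1.1.2, h.1.2.1.2⟩
    refine ⟨⟨i, h1.1⟩, ⟨j, h1.2⟩, rfl, rfl, ?_⟩
    rcases (hholds ⟨i, h1.1⟩ ⟨j, h1.2⟩ k l).1 h with h2 | ⟨h2, h3, a, b, -, -, h4⟩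
    · exact .inl h2
    · exact .inr ⟨h2, h3, a, b, h4⟩
  · rintro ⟨u, v, rfl, rfl, h⟩
    refine ⟨hM u, hM v, ?_⟩
    rcases h with h | ⟨h1, h2, a, b, h3⟩
    · exact ⟨0, by omega, 0, by omega, (hholds ..).2 (.inl h)⟩
    · exact ⟨a, hM a, b, hM b, (hholds ..).2 (.inr ⟨h1, h2, a, b, rfl, rfl, h3⟩)⟩

/-- Here the head `conf` also occurs in the body, so iteration is required. Every inserted pair is a
resolution step; conversely, the saturated table is closed under resolution and contains the base
conflicts, hence all of the inductively defined `Conflict`. -/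
theorem rulePass_resolve (hn : I.n < M)
    (hpart : ∀ i j, ρ .part i j ↔ ∃ a b : Fin I.n, (a : ℕ) = i ∧ (b : ℕ) = j ∧ I.Partner a b)
    (hconf : ∀ i j, ρ .conf i j ↔ ∃ a b : Fin I.n, (a : ℕ) = i ∧ (b : ℕ) = j ∧ I.BaseConflict a b)
    (i j : ℕ) :
    (rulePass M resolveForm .conf .u .v (ruleAssigns M))^[M * M] ρ .conf i j ↔
      ∃ a b : Fin I.n, (a : ℕ) = i ∧ (b : ℕ) = j ∧ I.Conflict a b := by
  have hM (a : Fin I.n) : (a : ℕ) < M := a.2.trans hn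
  constructor
  · let Q (ρ' : Rel → ℕ → ℕ → Prop) : Prop := ρ' .part = ρ .part ∧
      ∀ i j, ρ' .conf i j → ∃ a b : Fin I.n, (a : ℕ) = i ∧ (b : ℕ) = j ∧ I.Conflict a b
    suffices h : Q ((rulePass M resolveForm .conf .u .v (ruleAssigns M))^[M * M] ρ) from h.2 i j
    generalize M * M = k
    induction k with
    | zero =>
      refine ⟨rfl, fun i j h => ?_⟩
      obtain ⟨a, b, ha, hb, h⟩ := (hconf i j).1 h
      exact ⟨a, b, ha, hb, .base h⟩
    | succ k ih =>
      rw [iterate_succ_apply']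
      refine rulePass_induction _ (fun τ _ ρ' h h1 => ?_) ih
      obtain ⟨⟨h2, -⟩, ⟨h3, -⟩, ⟨h4, -⟩⟩ := h1
      refine ⟨?_, fun i j hij => ?_⟩
      · rw [← h.1]
        funext i j
        simp [insertRel]
      · rcases hij with hij | ⟨-, rfl, rfl, -⟩
        · exact h.2 i j hij
        · rw [h.1, hpart] at h2
          obtain ⟨a, b, ha, hb, hab⟩ := h2
          obtain ⟨u, a', hu, ha', hua⟩ := h.2 _ _ h3
          obtain ⟨v, b', hv, hb', hvb⟩ := h.2 _ _ h4
          obtain rfl : a = a' := Fin.ext (ha.trans ha'.symm)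
          obtain rfl : b = b' := Fin.ext (hb.trans hb'.symm)
          exact ⟨u, v, hu, hv, .resolve hab hua hvb⟩
  · rintro ⟨u, v, rfl, rfl, h⟩
    induction h with
    | @base u v h =>
      exact le_rulePass_iterate _ _ _ _ _ _ ((hconf _ _).2 ⟨u, v, rfl, rfl, h⟩)
    | @resolve u v a b hab _ _ ihu ihv =>
      refine rulePass_closed (rulePass_iterate_fixed _ ρ) (asg_mem (hM u) (hM v) (hM a) (hM b))
        ⟨⟨?_, hM a, hM b⟩, ⟨ihu, hM u, hM a⟩, ⟨ihv, hM v, hM b⟩⟩ (hM u) (hM v)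
      rw [rulePass_iterate_of_ne _ _ _ (by simp), hpart]
      exact ⟨a, b, rfl, rfl, hab⟩

/-- Since `z` is always `0`, the entry `(0, 0)` of `bad` serves as a Boolean flag for the existence
of an excluded class. -/
theorem rulePass_bad (hn : I.n < M)
    (hpart : ∀ i j, ρ .part i j ↔ ∃ a b : Fin I.n, (a : ℕ) = i ∧ (b : ℕ) = j ∧ I.Partner a b)
    (hconf : ∀ i j, ρ .conf i j ↔ ∃ a b : Fin I.n, (a : ℕ) = i ∧ (b : ℕ) = j ∧ I.Conflict a b)
    (h0 : ∀ i j, ¬ ρ .bad i j) :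
    testRel M (rulePass M badForm .bad .z .z (ruleAssigns M) ρ) .bad 0 0 ↔
      ∃ a b, I.Partner a b ∧ I.Conflict a a ∧ I.Conflict b b := by
  have hM (a : Fin I.n) : (a : ℕ) < M := a.2.trans hn
  have hM0 : 0 < M := by omega
  rw [testRel, rulePass_self (by simp [badForm, Form.Free])]
  constructor
  · rintro ⟨h | ⟨τ, -, ⟨⟨h1, -⟩, ⟨h2, -⟩, ⟨h3, -⟩⟩, -⟩, -⟩
    · exact (h0 _ _ h).elim
    · obtain ⟨a, b, ha, hb, hab⟩ := (hpart _ _).1 h1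
      obtain ⟨a', a'', ha', ha'', haa⟩ := (hconf _ _).1 h2
      obtain ⟨b', b'', hb', hb'', hbb⟩ := (hconf _ _).1 h3
      obtain rfl : a = a' := Fin.ext (ha.trans ha'.symm)
      obtain rfl : a = a'' := Fin.ext (ha.trans ha''.symm)
      obtain rfl : b = b' := Fin.ext (hb.trans hb'.symm)
      obtain rfl : b = b'' := Fin.ext (hb.trans hb''.symm)
      exact ⟨a, b, hab, haa, hbb⟩
  · rintro ⟨a, b, hab, haa, hbb⟩
    refine ⟨.inr ⟨_, asg_mem hM0 hM0 (hM a) (hM b), ?_, rfl, rfl, hM0, hM0⟩, hM0, hM0⟩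
    exact ⟨⟨(hpart _ _).2 ⟨a, b, rfl, rfl, hab⟩, hM a, hM b⟩,
      ⟨(hconf _ _).2 ⟨a, a, rfl, rfl, haa⟩, hM a, hM a⟩,
      ⟨(hconf _ _).2 ⟨b, b, rfl, rfl, hbb⟩, hM b, hM b⟩⟩

end rules

/-! ### Assembling the decision procedure. -/

section main

variable (I : ColoredGraph)

open Classical in
/-- The color and the row of the adjacency matrix of a vertex. -/
noncomputable def vertexData (i : Fin I.n) : List Bool × List Bool :=
  (encodeNat (I.φ i), List.ofFn fun j : Fin I.n => decide (I.G.Adj i j))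

theorem encode_eq : I.encode = ((List.ofFn (vertexData I)).map vertexWord).flatten := by
  rw [ColoredGraph.encode, List.map_ofFn]
  congr 2
  funext i
  simp only [ColoredGraph.encodeVertex, comp_apply, vertexWord, vertexData, List.map_ofFn]
  rfl

/-- A single vertex word contains a color and a full row, so the input length bounds the number of
vertices and all bit positions: every index needed fits below `M`. -/
theorem length_vertexWord_le (i : Fin I.n) :
    (encodeNat (I.φ i)).length + I.n ≤ I.encode.length := by
  have h1 : vertexWord (vertexData I i) ∈ (List.ofFn (vertexData I)).map vertexWord := by
    rw [List.map_ofFn]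
    exact List.mem_ofFn.2 ⟨i, rfl⟩
  have h2 := (List.sublist_flatten_of_mem h1).length_le
  rw [← encode_eq] at h2
  simp [vertexWord, vertexData] at h2
  omega

/-- The command that reads the input. -/
def parse : Cmd Var Rel :=
  .seq (rule ruleVars (.not (.rel Rel.bad .z .z)) Rel.eq .u .u) <|
  .seq (.zero .u) <| .seq (.zero .v) <| .seq (.zero .a) <| .loop (.read parseStep)

theorem act_parse (M : ℕ) (hM : M = I.encode.length + 1) :
    ∃ s : Abs Var Rel, parse.act M ⟨fun _ => 0, fun _ _ _ => False, I.encode⟩ = s ∧ s.c .z = 0 ∧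
      ∀ r i j, s.r r i j ↔ (r = .eq ∧ i = j ∧ i < M) ∨ ∃ d, (List.ofFn (vertexData I))[i]? = some d ∧
        i < M ∧ j < M ∧ VertexEntry d i r j := by
  have hM0 : 0 < M := by omega
  -- As `bad` is still empty, the premise always holds and the pass fills the diagonal of `eq`.
  obtain ⟨h1, h2, h3⟩ := act_rule M (vs := ruleVars) (by decide)
    (.not (.rel Rel.bad .z .z)) Rel.eq .u .u
    ⟨fun _ => 0, fun _ _ _ => False, I.encode⟩
  set s1 := (rule ruleVars (.not (.rel Rel.bad .z .z)) Rel.eq .u .u).act M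
    ⟨fun _ => 0, fun _ _ _ => False, I.encode⟩
  have hz : s1.c .z = 0 := h2 .z (by decide)
  have hr (r i j) : s1.r r i j ↔ r = .eq ∧ i = j ∧ i < M := by
    rw [h3]
    by_cases hr : r = .eq
    · subst hr
      rw [rulePass_u_u (by simp [Form.Free]) (by simp)]
      simp only [Form.Holds, testRel, false_and, not_false_eq_true, and_true, true_and]
      refine and_congr_right fun _ => and_iff_left ⟨0, hM0, 0, hM0, 0, hM0⟩
    · rw [rulePass_of_ne _ _ hr]
      simp [hr]
  -- The surplus `1` is the last round of the loop, which runs once more than there are letters and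
  -- reads from the exhausted input without effect.
  obtain ⟨ρ, h4, h5⟩ := iterate_read_vertexWords hM0 (List.ofFn (vertexData I)) 1
    (update (update (update s1.c .u 0) .v 0) .a 0) s1.r [] (by simp) (by simp) (by simp [hz])
    (by simp [hr])
  refine ⟨_, rfl, ?_⟩
  have h6 : parse.act M ⟨fun _ => 0, fun _ _ _ => False, I.encode⟩ =
      ⟨update (update (update (update s1.c .u 0) .v 0) .a 0) .u I.n, ρ, []⟩ := by
    have e : parse.act M ⟨fun _ => 0, fun _ _ _ => False, I.encode⟩ =
        ((Cmd.read parseStep).act M)^[M]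
          ⟨update (update (update s1.c .u 0) .v 0) .a 0, s1.r, s1.inp⟩ := rfl
    rw [List.append_nil, ← encode_eq, ← hM] at h4
    rw [e, h1]
    refine h4.trans ?_
    simp [Cmd.act, parseStep]
  rw [h6]
  refine ⟨by simp [hz], fun r i j => ?_⟩
  change ρ r i j ↔ _
  rw [h5, hr]
  simp

theorem getElem?_ofFn_vertexData {i : ℕ} {d : List Bool × List Bool} :
    (List.ofFn (vertexData I))[i]? = some d ↔ ∃ h : i < I.n, vertexData I ⟨i, h⟩ = d := by
  rw [List.getElem?_ofFn]
  split_ifs with h <;> simp [h]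

/-- The command that finds out whether there is no multicolored realization. -/
def decideCmd : Cmd Var Rel :=
  .seq parse <|
  .seq (rule ruleVars diffForm .diff .u .v) <|
  .seq (rule ruleVars mateForm .mate .u .u) <|
  .seq (rule ruleVars partForm .part .u .v) <|
  .seq (rule ruleVars confForm .conf .u .v) <|
  .seq (.loop (.loop (rule ruleVars resolveForm .conf .u .v)))
    (rule ruleVars badForm .bad .z .z)

/-- Of the counters only `z` has to be tracked from rule to rule; all others are rewritten by the
next pass. -/
theorem act_rule_ruleVars (M : ℕ) (f : Form Var Rel) (r : Rel) (x y : Var) {s : Abs Var Rel}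
    (hs : s.c .z = 0) : ∃ s', (rule ruleVars f r x y).act M s = s' ∧ s'.c .z = 0 ∧
      s'.r = rulePass M f r x y (ruleAssigns M) s.r ∧ ∀ r' ≠ r, s'.r r' = s.r r' := by
  obtain ⟨-, h1, h2⟩ := act_rule M (vs := ruleVars) (by decide) f r x y s
  rw [assigns_congr M ruleVars (c' := fun _ => 0)
    (by intro w hw; cases w <;> simp_all [ruleVars])] at h2
  exact ⟨_, rfl, (h1 .z (by decide)).trans hs, h2, fun r' h => by rw [h2, rulePass_of_ne _ _ h]⟩

theorem act_loop_loop_rule_ruleVars (M : ℕ) (f : Form Var Rel) (r : Rel) (x y : Var)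
    {s : Abs Var Rel} (hs : s.c .z = 0) :
    ∃ s', (Cmd.loop (.loop (rule ruleVars f r x y))).act M s = s' ∧ s'.c .z = 0 ∧
      s'.r = (rulePass M f r x y (ruleAssigns M))^[M * M] s.r ∧ ∀ r' ≠ r, s'.r r' = s.r r' := by
  obtain ⟨-, h1, h2⟩ := act_loop_loop_rule M (vs := ruleVars) (by decide) f r x y s
  rw [assigns_congr M ruleVars (c' := fun _ => 0)
    (by intro w hw; cases w <;> simp_all [ruleVars])] at h2
  exact ⟨_, rfl, (h1 .z (by decide)).trans hs, h2,
    fun r' h => by rw [h2, rulePass_iterate_of_ne _ _ _ h]⟩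

theorem testRel_decideCmd (M : ℕ) (hM : M = I.encode.length + 1) :
    let s := decideCmd.act M ⟨fun _ => 0, fun _ _ _ => False, I.encode⟩
    testRel M s.r .bad (s.c .z) (s.c .z) ↔
      ∃ a b, I.Partner a b ∧ I.Conflict a a ∧ I.Conflict b b := by
  obtain ⟨s1, e1, z1, r1⟩ := act_parse I M hM
  have hlen (i : Fin I.n) := length_vertexWord_le I i
  have hn : I.n < M := by
    rcases Nat.eq_zero_or_pos I.n with h | h
    · omega
    · have := hlen ⟨0, h⟩
      omega
  have hlen' (i : Fin I.n) : (encodeNat (I.φ i)).length < M := by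
    have := hlen i
    omega
  simp only [getElem?_ofFn_vertexData] at r1
  have heq (i j) : s1.r .eq i j ↔ i = j ∧ i < M := by
    simp [r1, VertexEntry]
  have hvert (i j) : s1.r .vert i j ↔ i = j ∧ i < I.n := by
    simp only [r1, VertexEntry]
    constructor
    · rintro (⟨h, -⟩ | ⟨_, ⟨h, rfl⟩, -, -, h1⟩)
      · cases h
      · simp at h1
        exact ⟨h1.symm, h⟩
    · rintro ⟨rfl, h⟩
      exact .inr ⟨_, ⟨h, rfl⟩, h.trans hn, h.trans hn, by simp⟩
  have hadj (i j) : s1.r .adj i j ↔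
      ∃ a b : Fin I.n, (a : ℕ) = i ∧ (b : ℕ) = j ∧ I.G.Adj a b := by
    simp only [r1, VertexEntry]
    constructor
    · rintro (⟨h, -⟩ | ⟨_, ⟨h, rfl⟩, -, -, h1⟩)
      · cases h
      · simp only [vertexData, List.getElem?_ofFn, reduceCtorEq, and_false, exists_false, and_true,
          false_and, or_false, false_or] at h1
        split_ifs at h1 with hj
        exact ⟨⟨i, h⟩, ⟨j, hj⟩, rfl, rfl, by simpa using h1⟩
    · rintro ⟨a, b, rfl, rfl, h⟩
      exact .inr ⟨_, ⟨a.2, rfl⟩, a.2.trans hn, b.2.trans hn,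
        .inr (.inl ⟨by simp [vertexData, h], trivial⟩)⟩
  have hbit (b i j) : s1.r (.bit b) i j ↔
      ∃ h : i < I.n, (encodeNat (I.φ ⟨i, h⟩))[j]? = some b := by
    simp only [r1, VertexEntry]
    constructor
    · rintro (⟨h, -⟩ | ⟨_, ⟨h, rfl⟩, -, -, h1⟩)
      · cases h
      · refine ⟨h, ?_⟩
        simpa [vertexData] using h1
    · rintro ⟨h, h1⟩
      have h2 := (List.getElem?_eq_some_iff.1 h1).1
      exact .inr ⟨_, ⟨h, rfl⟩, h.trans hn, h2.trans (hlen' _), .inl ⟨b, h1, rfl⟩⟩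
  have hdiff0 (i j) : ¬ s1.r .diff i j := by simp [r1, VertexEntry]
  have hmate0 (i j) : ¬ s1.r .mate i j := by simp [r1, VertexEntry]
  have hpart0 (i j) : ¬ s1.r .part i j := by simp [r1, VertexEntry]
  have hconf0 (i j) : ¬ s1.r .conf i j := by simp [r1, VertexEntry]
  have hbad0 (i j) : ¬ s1.r .bad i j := by simp [r1, VertexEntry]
  -- From here on, each stage changes only the table of its own head; the equations `o2`, …, `o6`
  -- carry the facts about the other tables over to the new state.
  obtain ⟨s2, e2, z2, r2, o2⟩ := act_rule_ruleVars M diffForm .diff .u .v z1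
  have d2 := rulePass_diff hn hlen' hbit hdiff0
  rw [← r2] at d2
  rw [← o2 _ (by simp)] at heq hvert hadj hmate0 hpart0 hconf0 hbad0
  obtain ⟨s3, e3, z3, r3, o3⟩ := act_rule_ruleVars M mateForm .mate .u .u z2
  have d3 := rulePass_mate hn heq hvert d2 hmate0
  rw [← r3] at d3
  rw [← o3 _ (by simp)] at heq hvert hadj d2 hpart0 hconf0 hbad0
  obtain ⟨s4, e4, z4, r4, o4⟩ := act_rule_ruleVars M partForm .part .u .v z3
  have d4 := rulePass_part hn heq hvert d2 d3 hpart0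
  rw [← r4] at d4
  rw [← o4 _ (by simp)] at heq hvert hadj d2 hconf0 hbad0
  obtain ⟨s5, e5, z5, r5, o5⟩ := act_rule_ruleVars M confForm .conf .u .v z4
  have d5 := rulePass_conf hn heq hvert hadj d2 hconf0
  rw [← r5] at d5
  rw [← o5 _ (by simp)] at d4 hbad0
  obtain ⟨s6, e6, z6, r6, o6⟩ := act_loop_loop_rule_ruleVars M resolveForm .conf .u .v z5
  have d6 := rulePass_resolve hn d4 d5
  rw [← r6] at d6
  rw [← o6 _ (by simp)] at d4 hbad0
  obtain ⟨s7, e7, z7, r7, -⟩ := act_rule_ruleVars M badForm .bad .z .z z6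
  have d7 := rulePass_bad hn d4 d6 hbad0
  rw [← r7] at d7
  have e8 : decideCmd.act M ⟨fun _ => 0, fun _ _ _ => False, I.encode⟩ = s7 := by
    rw [← e7, ← e6, ← e5, ← e4, ← e3, ← e2, ← e1]
    simp only [decideCmd, Cmd.act]
  intro s
  have hs : s = s7 := e8
  rw [hs, z7]
  exact d7

end main

end StackMachine

theorem mainTheorem8 :
    SolvableInPolyTime
      (fun I : {I : ColoredGraph // I.clusterSize ≤ 2} => I.val.encode)
      (fun I => I.val.HasMulticoloredRealization) := by
  refine StackMachine.solvableInPolyTime_of_cmd StackMachine.decideCmd .bad .z fun I => ?_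
  rw [ColoredGraph.hasMulticoloredRealization_iff I.2, not_iff_not]
  exact (StackMachine.testRel_decideCmd I.val _ rfl).symm
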